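/- All simplicial complexes are finite and abstract, the empty set is a face of each of them, and isomorphic complexes are identified. Definitions. For a finite set $\alpha$ let $\overline{\alpha}$ (resp. $\partial\alpha$) be the complex of all subsets (resp. all proper subsets) of $\alpha$, and let $*$ denote the join. The standard $d$-sphere $S^{d}_{d+2}$ is $\partial\sigma$ with $\#\sigma=d+2$. Let $X$ be a $d$-dimensional simplicial complex and let $\alpha,\beta$ be disjoint non-empty finite sets with $\dim\alpha+\dim\beta=d$ (where $\dim\alpha=\#\alpha-1$) such that the subcomplex of $X$ induced on $\alpha\sqcup\beta$ is $\overline{\alpha}*\partial\beta$. If $Y=(X\setminus(\overline{\alpha}*\partial\beta))\cup(\partial\alpha*\overline{\beta})$ is a simplicial complex, it is said to be obtained from $X$ by the bistellar move $\alpha\mapsto\beta$, of index $\dim\beta$ (in a move of index $0$, $\beta$ is a new vertex, not in $X$). A $d$-dimensional simplicial complex is $k$-stellated if it is obtained from $S^{d}_{d+2}$ by a finite (possibly empty) sequence of bistellar moves, each of index $<k$; in particular $S^{d}_{d+2}$ is the only $0$-stellated one. For $d\ge 1$ and $0\le k\le d$, $\mathcal{W}_k(d)$ is the class of connected $d$-dimensional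 simplicial complexes all of whose vertex links are $k$-stellated of dimension $d-1$. A complex is $l$-neighbourly if any $l$ of its vertices form a face. A polytope is the convex hull of a finite set of points in some $\mathbb{R}^n$; it is simplicial if all its proper faces are simplices. A polytopal sphere of dimension $d$ is a complex isomorphic to the boundary complex $\partial P=\{A\subseteq V(P): \operatorname{conv}(A)\text{ is a proper face of }P\}$ of a simplicial polytope $P$ of dimension $d+1$, where $V(P)$ is the set of vertices of $P$. Proposition. Let $k\ge 0$ and let $S$ be a $(k+1)$-neighbourly polytopal sphere of dimension $2k+1$. Then $S\in\mathcal{W}_k(2k+1)$; that is, $S$ is a connected simplicial complex of dimension $2k+1$, and the link of each vertex of $S$ is a $k$-stellated complex (sphere) of dimension $2k$. -/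

import Mathlib

/-! ### Convex polytopes -/

/-- A (convex) polytope: the convex hull of a finite set of points. -/
def IsPolytope {n : ℕ} (P : Set (EuclideanSpace ℝ (Fin n))) : Prop :=
  ∃ s : Finset (EuclideanSpace ℝ (Fin n)), P = convexHull ℝ (s : Set (EuclideanSpace ℝ (Fin n)))

/-- A proper face of `P`: a face, i.e. the intersection of `P` with a supporting hyperplane
(possibly empty), other than `P` itself. -/
def IsProperFace {n : ℕ} (P F : Set (EuclideanSpace ℝ (Fin n))) : Prop :=
  IsExposed ℝ P F ∧ F ≠ P

/-- A geometric simplex: the convex hull of a finite affinely independent set of points. -/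
def IsGeometricSimplex {n : ℕ} (F : Set (EuclideanSpace ℝ (Fin n))) : Prop :=
  ∃ s : Finset (EuclideanSpace ℝ (Fin n)),
    AffineIndependent ℝ (fun x : s => (x : EuclideanSpace ℝ (Fin n))) ∧
      F = convexHull ℝ (s : Set (EuclideanSpace ℝ (Fin n)))

/-- A simplicial polytope: a polytope all of whose proper faces are simplices. -/
def IsSimplicialPolytope {n : ℕ} (P : Set (EuclideanSpace ℝ (Fin n))) : Prop :=
  IsPolytope P ∧ ∀ F, IsProperFace P F → IsGeometricSimplex F

/-- The (nonempty) faces of the boundary complex of `P`: the nonempty sets `A` of vertices of `P`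
such that `conv A` is a proper face of `P`. The vertices of `P` are its zero-dimensional faces,
that is, its exposed points. -/
def boundaryFaces {n : ℕ} (P : Set (EuclideanSpace ℝ (Fin n))) :
    Set (Finset (EuclideanSpace ℝ (Fin n))) :=
  {A | A.Nonempty ∧ (A : Set (EuclideanSpace ℝ (Fin n))) ⊆ P.exposedPoints ℝ ∧
    IsProperFace P (convexHull ℝ (A : Set (EuclideanSpace ℝ (Fin n))))}

/-- Two families of finite sets are isomorphic if some map, injective on the points occurring in
the first family, carries the first family onto the second one. -/
def FaceIsomorphic {V W : Type*} (F : Set (Finset V)) (G : Set (Finset W)) : Prop :=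
  ∃ f : V → W, Set.InjOn f {v | ∃ A ∈ F, v ∈ A} ∧
    ∀ B : Finset W, B ∈ G ↔ ∃ A ∈ F, (B : Set W) = f '' (A : Set V)

/-! ### Abstract simplicial complexes

The faces of a `PreAbstractSimplicialComplex` are its *nonempty* faces; the empty face, which every
complex has, is left implicit. A point `v` of the ambient type is a vertex if `{v}` is a face. -/

namespace PreAbstractSimplicialComplex

/-- The complex `K` has dimension `d`. -/
def HasDim {V : Type*} (K : PreAbstractSimplicialComplex V) (d : ℕ) : Prop :=
  (∀ A ∈ K.faces, A.card ≤ d + 1) ∧ ∃ A ∈ K.faces, A.card = d + 1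

/-- The complex `K` is `l`-neighbourly: any `l` vertices of `K` form a face. -/
def IsNeighbourly {V : Type*} (K : PreAbstractSimplicialComplex V) (l : ℕ) : Prop :=
  ∀ A : Finset V, A.Nonempty → (∀ v ∈ A, {v} ∈ K.faces) → A.card = l → A ∈ K.faces

/-- The link of `x` in `K`. -/
def link {V : Type*} [DecidableEq V] (K : PreAbstractSimplicialComplex V) (x : V) :
    PreAbstractSimplicialComplex V where
  faces := {A | A.Nonempty ∧ x ∉ A ∧ insert x A ∈ K.faces}
  isRelLowerSet_faces := fun _ hA =>
    ⟨hA.1, fun _ hB hBne => ⟨hBne, fun h => hA.2.1 (hB h),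
      (K.isRelLowerSet_faces hA.2.2).2 (Finset.insert_subset_insert x hB)
        (Finset.insert_nonempty _ _)⟩⟩

/-- The edge graph of `K`, on the vertices of `K`. -/
def edgeGraph {V : Type*} [DecidableEq V] (K : PreAbstractSimplicialComplex V) :
    SimpleGraph {v : V // {v} ∈ K.faces} where
  Adj u v := u ≠ v ∧ {(u : V), (v : V)} ∈ K.faces
  symm := ⟨fun u v h => ⟨h.1.symm, by rw [Finset.pair_comm]; exact h.2⟩⟩
  loopless := ⟨fun _ h => h.1 rfl⟩

/-- A simplicial complex is connected if and only if its edge graph is. -/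
def IsConnected {V : Type*} [DecidableEq V] (K : PreAbstractSimplicialComplex V) : Prop :=
  K.edgeGraph.Connected

/-- The boundary complex `∂σ` of the simplex on the finite set `σ`: all proper subsets of `σ`. -/
def simplexBoundary {V : Type*} (σ : Finset V) : PreAbstractSimplicialComplex V where
  faces := {A | A.Nonempty ∧ A ⊂ σ}
  isRelLowerSet_faces := fun _ hA =>
    ⟨hA.1, fun _ hB hBne => ⟨hBne, lt_of_le_of_lt hB hA.2⟩⟩

/-- For disjoint `α` and `β`, the join of the full simplex on `α` with `∂β`: its faces are the
disjoint unions of a subset of `α` and a proper subset of `β`, i.e. the subsets of `α ∪ β` that do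
not contain `β`. -/
def simplexJoinBoundary {V : Type*} [DecidableEq V] (α β : Finset V) :
    PreAbstractSimplicialComplex V where
  faces := {A | A.Nonempty ∧ A ⊆ α ∪ β ∧ ¬ β ⊆ A}
  isRelLowerSet_faces := fun _ hA =>
    ⟨hA.1, fun _ hB hBne => ⟨hBne, hB.trans hA.2.1, fun h => hA.2.2 (h.trans hB)⟩⟩

/-- The `d`-dimensional complex `Y` is obtained from the `d`-dimensional complex `X` by the
bistellar move `α ↦ β`, whose index is `dim β = #β - 1`: the subcomplex of `X` induced on the set
`α ⊔ β` is the join of the full simplex on `α` with `∂β`, and `Y` arises from `X` by replacing it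
with the join of `∂α` and the full simplex on `β`. -/
structure IsBistellarMove {V : Type*} [DecidableEq V] (d : ℕ) (X Y : PreAbstractSimplicialComplex V)
    (α β : Finset V) : Prop where
  dim : X.HasDim d
  nonempty_left : α.Nonempty
  nonempty_right : β.Nonempty
  disjoint : Disjoint α β
  card_add : α.card + β.card = d + 2
  induced : {A | A ∈ X.faces ∧ A ⊆ α ∪ β} = (simplexJoinBoundary α β).faces
  result : Y.faces = (X.faces \ (simplexJoinBoundary α β).faces) ∪ (simplexJoinBoundary β α).faces

/-- `Y` is obtained from `X` (both of dimension `d`) by one bistellar move of index `< k`. -/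
def BistellarStep {V : Type*} [DecidableEq V] (d k : ℕ) (X Y : PreAbstractSimplicialComplex V) :
    Prop :=
  ∃ α β : Finset V, IsBistellarMove d X Y α β ∧ β.card - 1 < k

/-- The complex `X` is `k`-stellated of dimension `d`: up to isomorphism, it is obtained from the
standard `d`-sphere, the boundary complex of a simplex with `d + 2` vertices, by finitely many
bistellar moves of index `< k`. Up to isomorphism the vertices may be taken in `ℕ`, where a new
vertex is always available. -/
def IsStellated {V : Type*} (k d : ℕ) (X : PreAbstractSimplicialComplex V) : Prop :=
  ∃ (σ : Finset ℕ) (Y : PreAbstractSimplicialComplex ℕ), σ.card = d + 2 ∧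
    Relation.ReflTransGen (BistellarStep d k) (simplexBoundary σ) Y ∧
    FaceIsomorphic X.faces Y.faces

/-- The class `W_k(d)`, for `d ≥ 1`: the (finite) connected simplicial complexes of dimension `d`
all of whose vertex links are `k`-stellated of dimension `d - 1`. -/
structure MemW {V : Type*} [DecidableEq V] (k d : ℕ) (X : PreAbstractSimplicialComplex V) :
    Prop where
  one_le_dim : 1 ≤ d
  finite : X.faces.Finite
  connected : X.IsConnected
  dim : X.HasDim d
  link_stellated : ∀ v : V, {v} ∈ X.faces → IsStellated k (d - 1) (X.link v)

/-- The complex `X` is a polytopal `d`-sphere: it is isomorphic to the boundary complex of a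
simplicial polytope of dimension `d + 1`. -/
def IsPolytopalSphere {V : Type*} (d : ℕ) (X : PreAbstractSimplicialComplex V) : Prop :=
  ∃ (n : ℕ) (P : Set (EuclideanSpace ℝ (Fin n))), IsSimplicialPolytope P ∧
    Module.finrank ℝ (vectorSpan ℝ P) = d + 1 ∧ FaceIsomorphic X.faces (boundaryFaces P)

end PreAbstractSimplicialComplex

/-! Label the vertices of the polytope by a finite set `N` and replace affine functions by their
sequences of values at the vertices. They form a space `M` of dimension `2k + 3` containing the
constants, and the faces are the sets exposed by members of `M`.

Neighbourliness forces general position (`genPos_of_exposes`): in an affine dependence among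
vertices, the points with positive coefficients cannot form a face, so each sign occurs at least `k
+ 2` times. Hence no `2k + 3` vertices lie on a hyperplane, and this is inherited when a vertex `v`
is deleted.

Let `Q` be the hull of the vertices other than `v`. The link of `v` consists of the faces common to
a facet of `Q` visible from `v` and to an invisible one (`GenPos.link_eq_commonComplex`). Move a
point from `v` into `Q` along a generic ray. It crosses the hyperplanes of the visible facets one at
a time, and when a single visible facet is left, the common complex is the boundary of a simplex
(`GenPos.reachable`).

Read backwards, crossing the hyperplane of a facet `F` is a bistellar move `α ↦ β`, where `α` and
`β` are the vertices of `F` at which the crossing point has positive and negative barycentric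
coordinates (`GenPos.bistellarStep`). If `α` had at most `k + 1` elements, some functional exposing
`α` would be negative at the crossing point, yet its barycentric expansion there is nonnegative. So
`β` has at most `k` elements and the index is less than `k`.

Connectedness follows as in the simplex method: from any vertex other than the maximizer of a linear
function, some edge increases that function. -/

/-- `φ ∈ M` exposes the subset `A` of `N`: it vanishes on `A` and is negative on the rest of `N`. -/
structure Exposes (M : Submodule ℝ (ℕ → ℝ)) (N A : Finset ℕ) (φ : ℕ → ℝ) : Prop where
  mem : φ ∈ M
  sub : A ⊆ N
  zero : ∀ i ∈ A, φ i = 0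
  neg : ∀ i ∈ N, i ∉ A → φ i < 0

/-- `N` is in general position for the functionals in `M`: a nonzero functional has at most `D`
zeros in `N`. -/
def GenPos (M : Submodule ℝ (ℕ → ℝ)) (N : Finset ℕ) (D : ℕ) : Prop :=
  ∀ φ ∈ M, φ ≠ 0 → ∀ A ⊆ N, (∀ i ∈ A, φ i = 0) → A.card ≤ D

/-! ### Supporting functionals, pivoting and general position -/

section Functionals

variable {M : Submodule ℝ (ℕ → ℝ)} {N A F : Finset ℕ} {D : ℕ} {φ ψ : ℕ → ℝ}

theorem Exposes.nonpos (h : Exposes M N A φ) {i : ℕ} (hi : i ∈ N) : φ i ≤ 0 := by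
  by_cases hA : i ∈ A
  · exact (h.zero i hA).le
  · exact (h.neg i hi hA).le

theorem Exposes.ne_zero (h : Exposes M N A φ) (hA : A ≠ N) : φ ≠ 0 := fun h0 =>
  hA (h.sub.antisymm fun i hi => by
    by_contra hiA
    exact (h.neg i hi hiA).ne (congrFun h0 i))

theorem GenPos.mono {N' : Finset ℕ} (h : GenPos M N D) (hN : N' ⊆ N) : GenPos M N' D :=
  fun φ hφ h0 A hA => h φ hφ h0 A (hA.trans hN)

theorem exposes_of_nonpos (hφ : φ ∈ M) (h : ∀ i ∈ N, φ i ≤ 0) :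
    Exposes M N (N.filter fun i => φ i = 0) φ where
  mem := hφ
  sub := Finset.filter_subset _ _
  zero _ hi := (Finset.mem_filter.1 hi).2
  neg i hi hA := lt_of_le_of_ne (h i hi) fun h0 => hA (Finset.mem_filter.2 ⟨hi, h0⟩)

/-- The restriction of the functionals in `M` to a finite set of points. -/
def restrictPoints (M : Submodule ℝ (ℕ → ℝ)) (B : Finset ℕ) : M →ₗ[ℝ] (B → ℝ) :=
  LinearMap.funLeft ℝ ℝ (fun b : B => (b : ℕ)) ∘ₗ M.subtype

theorem restrictPoints_apply (B : Finset ℕ) (φ : M) (b : B) :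
    restrictPoints M B φ b = (φ : ℕ → ℝ) b := rfl

theorem finite_of_finrank_succ (hM : Module.finrank ℝ M = D + 1) : Module.Finite ℝ M :=
  Module.finite_of_finrank_pos (by omega)

/-- General position makes evaluation at `D + 1` points injective on a space of dimension `D + 1`,
hence bijective. -/
theorem GenPos.interpolate (h : GenPos M N D) (hM : Module.finrank ℝ M = D + 1)
    (hN : D + 1 ≤ N.card) {B : Finset ℕ} (hB : B ⊆ N) (hc : B.card ≤ D + 1) (g : ℕ → ℝ) :
    ∃ φ ∈ M, ∀ i ∈ B, φ i = g i := by
  obtain ⟨C, hBC, hCN, hC⟩ := Finset.exists_subsuperset_card_eq hB hc hN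
  have := finite_of_finrank_succ hM
  have hinj : Function.Injective (restrictPoints M C) := by
    rw [← LinearMap.ker_eq_bot, LinearMap.ker_eq_bot']
    intro φ hφ
    by_contra hne
    have := h φ φ.2 (fun h0 => hne (Subtype.ext h0)) C hCN
      (fun i hi => congrFun hφ ⟨i, hi⟩)
    omega
  have hsurj : Function.Surjective (restrictPoints M C) := by
    rw [← LinearMap.injective_iff_surjective_of_finrank_eq_finrank]
    · exact hinj
    · simp [hM, hC]
  obtain ⟨φ, hφ⟩ := hsurj fun b => g b
  exact ⟨φ, φ.2, fun i hi => congrFun hφ ⟨i, hBC hi⟩⟩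

/-- The supporting hyperplane of `φ` is rotated about `A`: with `s` the largest ratio `ψ i / (-φ i)`
over `N \ A`, the combination stays nonpositive and gains a zero at the maximizer. -/
theorem Exposes.pivot (h : Exposes M N A φ) (hA : A ≠ N) (hψM : ψ ∈ M) (hψ : ∀ i ∈ A, ψ i = 0) :
    ∃ s : ℝ, (ψ + s • φ) ∈ M ∧ (∀ i ∈ N, (ψ + s • φ) i ≤ 0) ∧
      ∃ b ∈ N, b ∉ A ∧ (ψ + s • φ) b = 0 := by
  have hne : (N \ A).Nonempty := by
    rw [Finset.sdiff_nonempty]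
    exact fun h' => hA (h.sub.antisymm h')
  obtain ⟨b, hb, hmax⟩ := Finset.exists_max_image (N \ A) (fun i => ψ i / (-φ i)) hne
  rw [Finset.mem_sdiff] at hb
  have hφb := h.neg b hb.1 hb.2
  refine ⟨ψ b / (-φ b), M.add_mem hψM (M.smul_mem _ h.mem), ?_, b, hb.1, hb.2, ?_⟩
  · intro i hi
    by_cases hiA : i ∈ A
    · simp [hψ i hiA, h.zero i hiA]
    · have hφi := h.neg i hi hiA
      have h1 := hmax i (Finset.mem_sdiff.2 ⟨hi, hiA⟩)
      rw [div_le_iff₀ (by linarith)] at h1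
      simp only [Pi.add_apply, Pi.smul_apply, smul_eq_mul]
      linarith
  · have : φ b ≠ 0 := hφb.ne
    simp only [Pi.add_apply, Pi.smul_apply, smul_eq_mul]
    field_simp
    ring

/-- Each pivot strictly enlarges the zero set, and general position caps its size at `D`. -/
theorem GenPos.exists_facet (hgp : GenPos M N D) (hM : Module.finrank ℝ M = D + 1)
    (hN : D + 1 ≤ N.card) (h : Exposes M N A φ) (hA : A.card ≤ D) :
    ∃ F φ', A ⊆ F ∧ F.card = D ∧ Exposes M N F φ' := by
  obtain ⟨n, hn⟩ : ∃ n, D - A.card = n := ⟨_, rfl⟩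
  induction n using Nat.strong_induction_on generalizing A φ with
  | _ n ih =>
    rcases hA.eq_or_lt with h1 | h1
    · exact ⟨A, φ, Finset.Subset.rfl, h1, h⟩
    have hcard : 2 ≤ (N \ A).card := by
      rw [Finset.card_sdiff_of_subset h.sub]
      omega
    obtain ⟨i, hi, j, hj, hij⟩ := Finset.one_lt_card.1 hcard
    rw [Finset.mem_sdiff] at hi hj
    -- The values 1 at `i` and 0 at `j` make `ψ` independent of `φ`, so that the pivoted functional
    -- is not zero.
    obtain ⟨ψ, hψM, hψ⟩ := hgp.interpolate hM hN (B := insert i (insert j A))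
      (by intro x; simp only [Finset.mem_insert]; rintro (rfl | rfl | hx)
          exacts [hi.1, hj.1, h.sub hx])
      (by have := Finset.card_insert_le i (insert j A); have := Finset.card_insert_le j A; omega)
      (fun x => if x = i then 1 else 0)
    have hψi : ψ i = 1 := by simpa using hψ i (by simp)
    have hψj : ψ j = 0 := by simpa [hij.symm] using hψ j (by simp)
    have hψA : ∀ x ∈ A, ψ x = 0 := fun x hx => by
      have hxi : x ≠ i := fun hxi => hi.2 (hxi ▸ hx)
      simpa [hxi] using hψ x (by simp [hx])
    obtain ⟨s, hmem, hle, b, hb, hbA, hb0⟩ :=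
      h.pivot (fun hAN => hi.2 (hAN ▸ hi.1)) hψM hψA
    have hne : ψ + s • φ ≠ 0 := fun h0 => by
      have h2 := congrFun h0 j
      have h3 := congrFun h0 i
      simp only [Pi.add_apply, Pi.smul_apply, smul_eq_mul, Pi.zero_apply, hψj, hψi, zero_add,
        mul_eq_zero] at h2 h3
      rcases h2 with h2 | h2
      · simp [h2] at h3
      · exact (h.neg j hj.1 hj.2).ne h2
    have hex := exposes_of_nonpos hmem hle
    have hc := hgp _ hmem hne _ hex.sub hex.zero
    have hAZ : A ⊆ N.filter fun i => (ψ + s • φ) i = 0 := fun x hx =>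
      Finset.mem_filter.2 ⟨h.sub hx, by simp [hψA x hx, h.zero x hx]⟩
    have hlt : A.card < (N.filter fun i => (ψ + s • φ) i = 0).card :=
      Finset.card_lt_card ⟨hAZ, fun h' => hbA (h' (Finset.mem_filter.2 ⟨hb, hb0⟩))⟩
    obtain ⟨F, φ', hF, hF'⟩ := ih _ (by omega) hex hc rfl
    exact ⟨F, φ', hAZ.trans hF, hF'⟩

/-- Pivot about the ridge `F.erase a`, with `a` removed from the point set. Since `φ a = 0`, the
value `-1` prescribed at `a` survives, so `a` stays strictly on the negative side. -/
theorem GenPos.exists_adjacent_facet (hgp : GenPos M N D) (hM : Module.finrank ℝ M = D + 1)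
    (hN : D + 1 ≤ N.card) (h : Exposes M N F φ) (hF : F.card = D) {a : ℕ} (ha : a ∈ F) :
    ∃ G φ', F.erase a ⊆ G ∧ a ∉ G ∧ G.card = D ∧ Exposes M N G φ' := by
  obtain ⟨ψ, hψM, hψ⟩ := hgp.interpolate hM hN h.sub (by omega) (fun x => if x = a then -1 else 0)
  have hψa : ψ a = -1 := by simpa using hψ a ha
  have hψF : ∀ x ∈ F.erase a, ψ x = 0 := fun x hx => by
    rw [Finset.mem_erase] at hx
    simpa [hx.1] using hψ x hx.2
  have h' : Exposes M (N.erase a) (F.erase a) φ :=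
    ⟨h.mem, Finset.erase_subset_erase _ h.sub, fun i hi => h.zero i (Finset.mem_of_mem_erase hi),
      fun i hi hi' => h.neg i (Finset.mem_of_mem_erase hi) fun hiF =>
        hi' (Finset.mem_erase.2 ⟨Finset.ne_of_mem_erase hi, hiF⟩)⟩
  have hne : F.erase a ≠ N.erase a := fun he => by
    have := congrArg Finset.card he
    rw [Finset.card_erase_of_mem ha, Finset.card_erase_of_mem (h.sub ha)] at this
    have : 0 < F.card := Finset.card_pos.2 ⟨a, ha⟩
    omega
  obtain ⟨s, hmem, hle, b, hb, hbA, hb0⟩ := h'.pivot hne hψM hψF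
  have hva : (ψ + s • φ) a = -1 := by simp [hψa, h.zero a ha]
  have hle' : ∀ i ∈ N, (ψ + s • φ) i ≤ 0 := fun i hi => by
    by_cases hia : i = a
    · rw [hia, hva]; norm_num
    · exact hle i (Finset.mem_erase.2 ⟨hia, hi⟩)
  have hne0 : ψ + s • φ ≠ 0 := fun h0 => by
    rw [h0] at hva
    norm_num at hva
  have hex := exposes_of_nonpos hmem hle'
  have hc := hgp _ hmem hne0 _ hex.sub hex.zero
  have hsub : F.erase a ⊆ N.filter fun i => (ψ + s • φ) i = 0 := fun x hx =>
    Finset.mem_filter.2 ⟨h.sub (Finset.mem_of_mem_erase hx), by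
      simp [hψF x hx, h.zero x (Finset.mem_of_mem_erase hx)]⟩
  have hlt : (F.erase a).card < (N.filter fun i => (ψ + s • φ) i = 0).card :=
    Finset.card_lt_card ⟨hsub, fun h' =>
      hbA (h' (Finset.mem_filter.2 ⟨Finset.mem_of_mem_erase hb, hb0⟩))⟩
  rw [Finset.card_erase_of_mem ha] at hlt
  refine ⟨_, _, hsub, fun ha' => ?_, by omega, hex⟩
  rw [(Finset.mem_filter.1 ha').2] at hva
  norm_num at hva

/-- Subtracting the multiple of `φ` that agrees with `ψ` at a point outside `F` leaves `D + 1`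
zeros. -/
theorem GenPos.eq_smul (hgp : GenPos M N D) (hN : D + 1 ≤ N.card) (h : Exposes M N F φ)
    (hF : F.card = D) (hψM : ψ ∈ M) (hψ : ∀ i ∈ F, ψ i = 0) : ∃ c : ℝ, ψ = c • φ := by
  obtain ⟨b, hb, hbF⟩ := Finset.exists_mem_notMem_of_card_lt_card (s := F) (t := N) (by omega)
  have hφb := (h.neg b hb hbF).ne
  refine ⟨ψ b / φ b, ?_⟩
  by_contra hne
  have := hgp (ψ - (ψ b / φ b) • φ) (M.sub_mem hψM (M.smul_mem _ h.mem)) (sub_ne_zero.2 hne)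
    (insert b F) (Finset.insert_subset hb h.sub) (by
      intro i hi
      rcases Finset.mem_insert.1 hi with rfl | hi
      · simp [hφb]
      · simp [hψ i hi, h.zero i hi])
  rw [Finset.card_insert_of_notMem hbF] at this
  omega

/-- A spanning set all of whose subsets with at most `k + 1` elements are exposed is in general
position for functionals forming a space of dimension `2 * k + 3`. -/
theorem genPos_of_exposes {k : ℕ} (hM : Module.finrank ℝ M = 2 * k + 3) (h1 : (1 : ℕ → ℝ) ∈ M)
    (hnb : ∀ A ⊆ N, A.card ≤ k + 1 → ∃ φ, Exposes M N A φ) : GenPos M N (2 * k + 2) := by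
  intro φ hφ hφ0 A' hA'N hA'
  by_contra hlt
  obtain ⟨B, hBA, hB⟩ := Finset.exists_subset_card_eq (show 2 * k + 3 ≤ A'.card by omega)
  have hBN := hBA.trans hA'N
  have := finite_of_finrank_succ (D := 2 * k + 2) hM
  have hninj : ¬ Function.Injective (restrictPoints M B) := fun hinj => by
    refine hφ0 (congrArg Subtype.val (@hinj ⟨φ, hφ⟩ 0 ?_))
    ext b
    exact hA' b (hBA b.2)
  have hnsurj : ¬ Function.Surjective (restrictPoints M B) := by
    rw [← LinearMap.injective_iff_surjective_of_finrank_eq_finrank]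
    · exact hninj
    · simp [hM, hB]
  rw [← LinearMap.range_eq_top] at hnsurj
  -- A nonzero linear form on the values at `B` that annihilates `M` is an affine dependence `lam`
  -- among the `2k + 3` points of `B`.
  obtain ⟨l, hl0, hl⟩ := Submodule.exists_le_ker_of_lt_top _ (lt_top_iff_ne_top.2 hnsurj)
  set lam : B → ℝ := fun b => l (Pi.single b 1) with hlam
  have hlsum : ∀ ψ ∈ M, ∑ b : B, lam b * ψ b = 0 := fun ψ hψ => by
    have h2 : l (restrictPoints M B ⟨ψ, hψ⟩) = 0 := hl ⟨_, rfl⟩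
    rw [LinearMap.pi_apply_eq_sum_univ] at h2
    rw [← h2]
    refine Finset.sum_congr rfl fun b _ => ?_
    rw [smul_eq_mul, mul_comm, restrictPoints_apply]
    refine congrArg (ψ b * l ·) (funext fun j => ?_)
    simp [Pi.single_apply, eq_comm]
  have hne : ∃ b, lam b ≠ 0 := by
    by_contra! h
    refine hl0 (LinearMap.pi_ext' fun b => LinearMap.ext_ring ?_)
    simpa [hlam] using h b
  -- Otherwise a functional exposes the positive part of `μ`. All terms of its sum against `μ` are
  -- then nonnegative, so they vanish and `μ` has no negative entry; pairing with the constant 1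
  -- gives `μ = 0`. Applied to `lam` and `-lam`, this demands `2k + 4` points.
  have key : ∀ μ : B → ℝ, (∀ ψ ∈ M, ∑ b : B, μ b * ψ b = 0) → (∃ b, μ b ≠ 0) →
      k + 1 < (Finset.univ.filter fun b => 0 < μ b).card := by
    intro μ hμ hμ0
    by_contra hle
    obtain ⟨ψ, hψ⟩ := hnb ((Finset.univ.filter fun b => 0 < μ b).map (Function.Embedding.subtype _))
      (fun x hx => by
        simp only [Finset.mem_map, Finset.mem_filter] at hx
        obtain ⟨y, -, rfl⟩ := hx
        exact hBN y.2)
      (by rw [Finset.card_map]; omega)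
    have hterm : ∀ b : B, 0 ≤ μ b * ψ b := fun b => by
      by_cases hb : 0 < μ b
      · rw [hψ.zero b (Finset.mem_map.2 ⟨b, by simp [hb], rfl⟩)]
        simp
      · exact mul_nonneg_of_nonpos_of_nonpos (not_lt.1 hb) (hψ.nonpos (hBN b.2))
    have hz := (Finset.sum_eq_zero_iff_of_nonneg fun b _ => hterm b).1 (hμ ψ hψ.mem)
    have hnn : ∀ b : B, 0 ≤ μ b := fun b => by
      by_contra hb
      have hb' := hz b (Finset.mem_univ _)
      have hnot : (b : ℕ) ∉ (Finset.univ.filter fun b => 0 < μ b).map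
          (Function.Embedding.subtype _) := by
        simp only [Finset.mem_map, Finset.mem_filter, not_exists]
        rintro y ⟨⟨-, hy⟩, hyb⟩
        have : y = b := Subtype.ext hyb
        subst this
        linarith
      have := mul_pos_of_neg_of_neg (not_le.1 hb) (hψ.neg b (hBN b.2) hnot)
      linarith
    have h3 := hμ 1 h1
    simp only [Pi.one_apply, mul_one] at h3
    obtain ⟨b, hb⟩ := hμ0
    exact hb ((Finset.sum_eq_zero_iff_of_nonneg fun b _ => hnn b).1 h3 b (Finset.mem_univ _))
  have hp := key lam hlsum hne
  have hn := key (fun b => -lam b) (fun ψ hψ => by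
    simpa only [neg_mul, Finset.sum_neg_distrib, neg_eq_zero] using hlsum ψ hψ) (by simpa using hne)
  have hd : Disjoint (Finset.univ.filter fun b => 0 < lam b)
      (Finset.univ.filter fun b => 0 < -lam b) := by
    rw [Finset.disjoint_filter]
    intro b _ h4 h5
    linarith
  have := Finset.card_le_univ ((Finset.univ.filter fun b => 0 < lam b).disjUnion
    (Finset.univ.filter fun b => 0 < -lam b) hd)
  rw [Finset.card_disjUnion, Fintype.card_coe, hB] at this
  omega

/-- Finitely many functionals, none of them zero on all of `N`, are nonzero at a common positive
combination of the points of `N`. -/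
theorem exists_generic_weights (N : Finset ℕ) (T : Finset (ℕ → ℝ))
    (hT : ∀ φ ∈ T, ∃ i ∈ N, φ i ≠ 0) :
    ∃ w : ℕ → ℝ, (∀ i, 0 < w i) ∧ ∀ φ ∈ T, ∑ i ∈ N, w i * φ i ≠ 0 := by
  classical
  -- The weights are powers `x ^ i`: each functional becomes a nonzero polynomial in `x`, and a
  -- positive `x` avoids the finitely many roots.
  let p : (ℕ → ℝ) → Polynomial ℝ := fun φ => ∑ i ∈ N, Polynomial.monomial i (φ i)
  have hp : ∀ φ ∈ T, p φ ≠ 0 := fun φ hφ h0 => by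
    obtain ⟨i, hi, hne⟩ := hT φ hφ
    have := congrArg (fun q => Polynomial.coeff q i) h0
    simp [p, Polynomial.finsetSum_coeff, Polynomial.coeff_monomial, hi] at this
    exact hne this
  have hfin : (⋃ φ ∈ T, {x : ℝ | (p φ).IsRoot x}).Finite :=
    T.finite_toSet.biUnion fun φ hφ => Polynomial.finite_setOfPred_isRoot (hp φ hφ)
  obtain ⟨x, hx, hxn⟩ := (Set.Ioi_infinite (0 : ℝ)).exists_notMem_finite hfin
  refine ⟨fun i => x ^ i, fun i => pow_pos hx i, fun φ hφ h0 => hxn ?_⟩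
  simp only [Set.mem_iUnion, Set.mem_ofPred_eq, Polynomial.IsRoot]
  refine ⟨φ, hφ, ?_⟩
  rw [← h0]
  simp [p, Polynomial.eval_finsetSum, Polynomial.eval_monomial, mul_comm]

end Functionals

/-! ### Crossing one facet hyperplane is a bistellar move -/

/-- The complex of the nonempty sets contained both in a member of `P` and in a member of `Q`. -/
def commonComplex (P Q : Set (Finset ℕ)) : PreAbstractSimplicialComplex ℕ where
  faces := {A | A.Nonempty ∧ (∃ F ∈ P, A ⊆ F) ∧ ∃ G ∈ Q, A ⊆ G}
  isRelLowerSet_faces := fun _ hA => ⟨hA.1, fun _ hB hBne =>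
    ⟨hBne, hA.2.1.imp fun _ h => ⟨h.1, hB.trans h.2⟩, hA.2.2.imp fun _ h => ⟨h.1, hB.trans h.2⟩⟩⟩

/-- The vertex sets of the facets of the polytope spanned by the points of `N`. -/
def facetSets (M : Submodule ℝ (ℕ → ℝ)) (N : Finset ℕ) (D : ℕ) : Set (Finset ℕ) :=
  {F | F.card = D ∧ ∃ φ, Exposes M N F φ}

section Crossing

open PreAbstractSimplicialComplex

variable {M : Submodule ℝ (ℕ → ℝ)} {N F : Finset ℕ} {D : ℕ} {φ : ℕ → ℝ}
  {Φ : Finset ℕ → ℕ → ℝ} {X : (ℕ → ℝ) →ₗ[ℝ] ℝ} {lam : ℕ → ℝ}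

/-- `X` plays the role of evaluation at a point of the hyperplane of `F`. Interpolating `ψ` on `F`
by the dual functionals `η a` leaves a multiple of `φ`, which `X` kills. -/
theorem GenPos.exists_barycentric (hgp : GenPos M N D) (hM : Module.finrank ℝ M = D + 1)
    (hN : D + 1 ≤ N.card) (h : Exposes M N F φ) (hF : F.card = D) (hX : X φ = 0) :
    ∃ lam : ℕ → ℝ, ∀ ψ ∈ M, X ψ = ∑ a ∈ F, lam a * ψ a := by
  have hex : ∀ a, ∃ η ∈ M, ∀ i ∈ F, η i = if i = a then 1 else 0 := fun a =>
    hgp.interpolate hM hN h.sub (by omega) fun i => if i = a then 1 else 0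
  choose η hηM hη using hex
  refine ⟨fun a => X (η a), fun ψ hψ => ?_⟩
  obtain ⟨c, hc⟩ := hgp.eq_smul hN h hF (ψ := ψ - ∑ a ∈ F, ψ a • η a)
    (M.sub_mem hψ (M.sum_mem fun a _ => M.smul_mem _ (hηM a))) (fun i hi => by
      simp only [Pi.sub_apply, Finset.sum_apply, Pi.smul_apply, smul_eq_mul]
      rw [Finset.sum_eq_single i]
      · simp [hη i i hi]
      · intro b _ hb
        simp [hη b i hi, hb.symm]
      · exact fun h' => absurd hi h')
  have h2 := congrArg X hc
  simp only [map_sub, map_sum, map_smul, smul_eq_mul, hX, mul_zero, sub_eq_zero] at h2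
  rw [h2]
  exact Finset.sum_congr rfl fun a _ => mul_comm _ _

/-- On the facet adjacent to `F` across the ridge opposite `a`, only the term of `a` survives in the
barycentric expansion, so the sign of `lam a` decides on which side of that facet `X` lies. -/
theorem GenPos.exists_facet_single (hgp : GenPos M N D) (hM : Module.finrank ℝ M = D + 1)
    (hN : D + 1 ≤ N.card) (hΦ : ∀ G ∈ facetSets M N D, Exposes M N G (Φ G))
    (hF : F ∈ facetSets M N D) (hX : ∀ ψ ∈ M, X ψ = ∑ a ∈ F, lam a * ψ a) {a : ℕ} (ha : a ∈ F) :
    ∃ G ∈ facetSets M N D, F.erase a ⊆ G ∧ a ∉ G ∧ Φ G a < 0 ∧ X (Φ G) = lam a * Φ G a := by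
  obtain ⟨G, φ', hsub, haG, hG, hex⟩ :=
    hgp.exists_adjacent_facet hM hN (hΦ F hF) hF.1 ha
  have hG' : G ∈ facetSets M N D := ⟨hG, φ', hex⟩
  refine ⟨G, hG', hsub, haG, (hΦ G hG').neg a ((hΦ F hF).sub ha) haG, ?_⟩
  rw [hX _ (hΦ G hG').mem, Finset.sum_eq_single a]
  · intro b hb hba
    rw [(hΦ G hG').zero b (hsub (Finset.mem_erase.2 ⟨hba, hb⟩)), mul_zero]
  · exact fun h' => absurd ha h'

/-- A face of the facet `F` lies in a facet on the positive side of the point `X` of the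
hyperplane of `F` if and only if it misses a vertex with negative barycentric coordinate. -/
theorem GenPos.exists_pos_facet_iff (hgp : GenPos M N D) (hM : Module.finrank ℝ M = D + 1)
    (hN : D + 1 ≤ N.card) (hΦ : ∀ G ∈ facetSets M N D, Exposes M N G (Φ G))
    (hF : F ∈ facetSets M N D) (hX : ∀ ψ ∈ M, X ψ = ∑ a ∈ F, lam a * ψ a) {A : Finset ℕ}
    (hA : A ⊆ F) :
    (∃ G ∈ facetSets M N D, 0 < X (Φ G) ∧ A ⊆ G) ↔ ¬ (F.filter fun a => lam a < 0) ⊆ A := by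
  constructor
  · rintro ⟨G, hG, hpos, hAG⟩ hsub
    rw [hX _ (hΦ G hG).mem] at hpos
    refine hpos.not_ge (Finset.sum_nonpos fun a ha => ?_)
    by_cases haA : a ∈ A
    · rw [(hΦ G hG).zero a (hAG haA), mul_zero]
    · have : 0 ≤ lam a := not_lt.1 fun h => haA (hsub (Finset.mem_filter.2 ⟨ha, h⟩))
      exact mul_nonpos_of_nonneg_of_nonpos this ((hΦ G hG).nonpos ((hΦ F hF).sub ha))
  · intro hsub
    obtain ⟨a, ha, haA⟩ := Finset.not_subset.1 hsub
    rw [Finset.mem_filter] at ha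
    obtain ⟨G, hG, hFG, -, hneg, hXG⟩ := hgp.exists_facet_single hM hN hΦ hF hX ha.1
    refine ⟨G, hG, hXG ▸ mul_pos_of_neg_of_neg ha.2 hneg, fun x hx => hFG ?_⟩
    exact Finset.mem_erase.2 ⟨fun h => haA (h ▸ hx), hA hx⟩

theorem card_lt_of_subset_of_ne {A G H : Finset ℕ} (hG : G.card = D) (hH : H.card = D)
    (hne : G ≠ H) (hAG : A ⊆ G) (hAH : A ⊆ H) : A.card < D := by
  refine lt_of_le_of_ne (hG ▸ Finset.card_le_card hAG) fun h => hne ?_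
  rw [← Finset.eq_of_subset_of_card_le hAG (by omega),
    Finset.eq_of_subset_of_card_le hAH (by omega)]

/-- When a point crosses the hyperplane of exactly one facet, the separating complex undergoes a
bistellar move. -/
theorem GenPos.bistellarStep {k : ℕ} (hgp : GenPos M N (2 * k + 2))
    (hM : Module.finrank ℝ M = 2 * k + 3) (h1 : (1 : ℕ → ℝ) ∈ M) (hN : 2 * k + 3 ≤ N.card)
    (hΦ : ∀ G ∈ facetSets M N (2 * k + 2), Exposes M N G (Φ G))
    (hF : F ∈ facetSets M N (2 * k + 2)) (hXF : X (Φ F) = 0)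
    (hXne : ∀ G ∈ facetSets M N (2 * k + 2), G ≠ F → X (Φ G) ≠ 0)
    (hpos : ∃ G ∈ facetSets M N (2 * k + 2), 0 < X (Φ G)) (hX1 : 0 < X 1)
    (hnb : ∀ A ⊆ N, A.card ≤ k + 1 → ∃ φ, Exposes M N A φ ∧ X φ < 0) :
    BistellarStep (2 * k) k
      (commonComplex {G | G ∈ facetSets M N (2 * k + 2) ∧ 0 < X (Φ G)}
        {G | G ∈ facetSets M N (2 * k + 2) ∧ X (Φ G) ≤ 0})
      (commonComplex {G | G ∈ facetSets M N (2 * k + 2) ∧ 0 ≤ X (Φ G)}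
        {G | G ∈ facetSets M N (2 * k + 2) ∧ X (Φ G) < 0}) := by
  obtain ⟨lam, hlam⟩ := hgp.exists_barycentric hM hN (hΦ F hF) hF.1 hXF
  have hnear := fun A (hA : A ⊆ F) => hgp.exists_pos_facet_iff hM hN hΦ hF hlam hA
  -- Reversing the sign of `X` exchanges visible and invisible facets, and `β` with `α`.
  have hfar := fun A (hA : A ⊆ F) => hgp.exists_pos_facet_iff (X := -X) (lam := fun a => -lam a)
    hM hN hΦ hF (fun ψ hψ => by simp [hlam ψ hψ]) hA
  simp only [LinearMap.neg_apply, Left.neg_pos_iff, Left.neg_neg_iff] at hfar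
  -- A zero coordinate would put `X` on the hyperplane of a second facet.
  have hlam0 : ∀ a ∈ F, lam a ≠ 0 := fun a ha h0 => by
    obtain ⟨G, hG, -, haG, -, hXG⟩ := hgp.exists_facet_single hM hN hΦ hF hlam ha
    exact hXne G hG (fun h => haG (h ▸ ha)) (by rw [hXG, h0, zero_mul])
  set α := F.filter fun a => 0 < lam a with hα
  set β := F.filter fun a => lam a < 0 with hβ
  have hαβ : α ∪ β = F := by
    ext a
    simp only [hα, hβ, Finset.mem_union, Finset.mem_filter]
    have := fun ha => lt_or_gt_of_ne (hlam0 a ha)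
    tauto
  have hdisj : Disjoint α β := by
    rw [hα, hβ, Finset.disjoint_filter]
    exact fun a _ h2 h3 => h2.not_gt h3
  have hcard : α.card + β.card = 2 * k + 2 := by
    rw [← Finset.card_union_of_disjoint hdisj, hαβ, hF.1]
  have hαne : α.Nonempty := by
    rw [hlam 1 h1] at hX1
    by_contra hempty
    refine hX1.not_ge (Finset.sum_nonpos fun a ha => ?_)
    simpa using not_lt.1 fun hpos => hempty ⟨a, Finset.mem_filter.2 ⟨ha, hpos⟩⟩
  have hβne : β.Nonempty := by
    by_contra hempty
    rw [Finset.not_nonempty_iff_eq_empty] at hempty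
    refine (hnear ∅ (Finset.empty_subset _)).1 ?_ (by rw [hempty])
    exact hpos.imp fun G hG => ⟨hG.1, hG.2, Finset.empty_subset _⟩
  -- If a functional exposes `α`, only the terms of `β` remain in its expansion, and these are
  -- products of two nonpositive numbers.
  have hαcard : k + 2 ≤ α.card := by
    by_contra hlt
    obtain ⟨φ, hφ, hneg⟩ := hnb α ((Finset.filter_subset _ _).trans (hΦ F hF).sub) (by omega)
    rw [hlam φ hφ.mem] at hneg
    refine hneg.not_ge (Finset.sum_nonneg fun a ha => ?_)
    rcases lt_or_gt_of_ne (hlam0 a ha) with hl | hl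
    · exact mul_nonneg_of_nonpos_of_nonpos hl.le (hφ.nonpos ((hΦ F hF).sub ha))
    · rw [hφ.zero a (Finset.mem_filter.2 ⟨ha, hl⟩), mul_zero]
  have hXmem : ∀ A, A ⊆ F → (A ∈ (commonComplex {G | G ∈ facetSets M N (2 * k + 2) ∧ 0 < X (Φ G)}
      {G | G ∈ facetSets M N (2 * k + 2) ∧ X (Φ G) ≤ 0}).faces ↔ A.Nonempty ∧ ¬ β ⊆ A) := by
    intro A hA
    rw [← hnear A hA]
    constructor
    · rintro ⟨hne, ⟨G, hG, hAG⟩, -⟩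
      exact ⟨hne, G, hG.1, hG.2, hAG⟩
    · rintro ⟨hne, G, hG, hpos, hAG⟩
      exact ⟨hne, ⟨G, ⟨hG, hpos⟩, hAG⟩, F, ⟨hF, hXF.le⟩, hA⟩
  have hYmem : ∀ A, A ⊆ F → (A ∈ (commonComplex {G | G ∈ facetSets M N (2 * k + 2) ∧ 0 ≤ X (Φ G)}
      {G | G ∈ facetSets M N (2 * k + 2) ∧ X (Φ G) < 0}).faces ↔ A.Nonempty ∧ ¬ α ⊆ A) := by
    intro A hA
    rw [← hfar A hA]
    constructor
    · rintro ⟨hne, -, G, hG, hAG⟩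
      exact ⟨hne, G, hG.1, hG.2, hAG⟩
    · rintro ⟨hne, G, hG, hpos, hAG⟩
      exact ⟨hne, ⟨F, ⟨hF, hXF.ge⟩, hA⟩, G, ⟨hG, hpos⟩, hAG⟩
  refine ⟨α, β, ⟨?_, hαne, hβne, hdisj, hcard, ?_, ?_⟩,
    by have := hβne.card_pos; omega⟩
  · constructor
    · rintro A ⟨-, ⟨G, hG, hAG⟩, H, hH, hAH⟩
      have := card_lt_of_subset_of_ne hG.1.1 hH.1.1
        (fun h => hG.2.not_ge (h ▸ hH.2)) hAG hAH
      omega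
    · obtain ⟨a, ha⟩ := hβne
      have haF := (Finset.mem_filter.1 ha).1
      have hc : (F.erase a).card = 2 * k + 1 := by
        rw [Finset.card_erase_of_mem haF, hF.1]
        omega
      refine ⟨F.erase a, (hXmem _ (Finset.erase_subset _ _)).2
        ⟨Finset.card_pos.1 (by omega), fun h => ?_⟩, hc⟩
      exact absurd (h ha) (Finset.notMem_erase a F)
  · ext A
    simp only [simplexJoinBoundary, hαβ, Set.mem_ofPred_eq]
    constructor
    · rintro ⟨hA, hAF⟩
      obtain ⟨hne, hs⟩ := (hXmem A hAF).1 hA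
      exact ⟨hne, hAF, hs⟩
    · rintro ⟨hne, hAF, hs⟩
      exact ⟨(hXmem A hAF).2 ⟨hne, hs⟩, hAF⟩
  · ext A
    simp only [simplexJoinBoundary, hαβ, Finset.union_comm β α, Set.mem_union, Set.mem_sdiff]
    by_cases hAF : A ⊆ F
    · rw [hXmem A hAF, hYmem A hAF]
      simp only [Set.mem_ofPred_eq]
      tauto
    -- Facets containing a set not inside `F` differ from `F`, so none of them changes side.
    · have hs : ∀ G ∈ facetSets M N (2 * k + 2), A ⊆ G → X (Φ G) ≠ 0 := fun G hG hAG =>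
        hXne G hG fun h => hAF (h ▸ hAG)
      simp only [hAF, false_and, and_false, Set.mem_ofPred_eq, or_false, not_false_eq_true,
        and_true, commonComplex]
      refine and_congr_right fun _ => and_congr (exists_congr fun G => and_congr_left fun hAG =>
        and_congr_right fun hG => ?_) (exists_congr fun G => and_congr_left fun hAG =>
        and_congr_right fun hG => ?_)
      · exact ⟨fun h => lt_of_le_of_ne h (hs G hG hAG).symm, fun h => h.le⟩
      · exact ⟨fun h => h.le, fun h => lt_of_le_of_ne h (hs G hG hAG)⟩

end Crossing

/-! ### Sweeping a point along a generic ray -/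

section Sweep

open PreAbstractSimplicialComplex

variable {M : Submodule ℝ (ℕ → ℝ)} {N F : Finset ℕ} {D : ℕ} {φ : ℕ → ℝ} {Φ : Finset ℕ → ℕ → ℝ}

theorem facetSets_finite : (facetSets M N D).Finite :=
  (N.powerset.finite_toSet).subset fun F hF => by
    obtain ⟨-, φ, hφ⟩ := hF
    simpa using hφ.sub

/-- If the facet `F` is the only one in `P`, then the separating complex is the boundary of `F`. -/
theorem GenPos.commonComplex_singleton (hgp : GenPos M N D) (hM : Module.finrank ℝ M = D + 1)
    (hN : D + 1 ≤ N.card) (hF : F ∈ facetSets M N D) :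
    commonComplex {F} {G | G ∈ facetSets M N D ∧ G ≠ F} = simplexBoundary F := by
  refine PreAbstractSimplicialComplex.ext (Set.ext fun A => ?_)
  simp only [commonComplex, simplexBoundary, Set.mem_ofPred_eq, Set.mem_singleton_iff,
    exists_eq_left]
  refine and_congr_right fun _ => ⟨?_, fun h => ⟨h.1, ?_⟩⟩
  · rintro ⟨hAF, G, ⟨hG, hne⟩, hAG⟩
    have := card_lt_of_subset_of_ne hG.1 hF.1 hne hAG hAF
    exact hAF.ssubset_of_ne fun h => by rw [h, hF.1] at this; omega
  -- A proper subset of `F` misses some `a`, hence lies in the facet adjacent to `F` across the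
  -- ridge opposite `a`.
  · obtain ⟨a, ha, haA⟩ := Finset.exists_of_ssubset h
    obtain ⟨-, φ, hφ⟩ := id hF
    obtain ⟨G, φ', hsub, haG, hG, hex⟩ := hgp.exists_adjacent_facet hM hN hφ hF.1 ha
    exact ⟨G, ⟨⟨hG, φ', hex⟩, fun h' => haG (h' ▸ ha)⟩,
      fun x hx => hsub (Finset.mem_erase.2 ⟨fun h' => haA (h' ▸ hx), h.1 hx⟩)⟩

/-- Sweeping a point along a generic ray realizes the separating complex by bistellar moves. -/
theorem GenPos.reachable {k : ℕ} (hgp : GenPos M N (2 * k + 2))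
    (hM : Module.finrank ℝ M = 2 * k + 3) (h1 : (1 : ℕ → ℝ) ∈ M) (hN : 2 * k + 3 ≤ N.card)
    (hΦ : ∀ G ∈ facetSets M N (2 * k + 2), Exposes M N G (Φ G)) (τ : Finset ℕ → ℝ)
    (hτ : Set.InjOn τ (facetSets M N (2 * k + 2))) (X : ℝ → (ℕ → ℝ) →ₗ[ℝ] ℝ)
    (hX : ∀ r, ∀ G ∈ facetSets M N (2 * k + 2), ∃ c : ℝ, 0 < c ∧ X r (Φ G) = c * (τ G - r))
    (hX1 : ∀ r, 0 ≤ r → 0 < X r 1)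
    (hnb : ∀ r, 0 ≤ r → ∀ A ⊆ N, A.card ≤ k + 1 → ∃ φ, Exposes M N A φ ∧ X r φ < 0)
    (n : ℕ) (r : ℝ) (hr : 0 ≤ r) (hn : {G | G ∈ facetSets M N (2 * k + 2) ∧ r < τ G}.ncard = n + 1) :
    ∃ σ : Finset ℕ, σ.card = 2 * k + 2 ∧
      Relation.ReflTransGen (BistellarStep (2 * k) k) (simplexBoundary σ)
        (commonComplex {G | G ∈ facetSets M N (2 * k + 2) ∧ r < τ G}
          {G | G ∈ facetSets M N (2 * k + 2) ∧ τ G ≤ r}) := by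
  have hpos : ∀ r, ∀ G ∈ facetSets M N (2 * k + 2), (0 < X r (Φ G) ↔ r < τ G) := by
    intro r G hG
    obtain ⟨c, hc, h⟩ := hX r G hG
    rw [h, mul_pos_iff_of_pos_left hc, sub_pos]
  have hneg : ∀ r, ∀ G ∈ facetSets M N (2 * k + 2), (X r (Φ G) < 0 ↔ τ G < r) := by
    intro r G hG
    obtain ⟨c, hc, h⟩ := hX r G hG
    rw [h, ← neg_pos, ← mul_neg, mul_pos_iff_of_pos_left hc, neg_sub, sub_pos]
  induction n generalizing r with
  | zero =>
    obtain ⟨F, hF⟩ := Set.ncard_eq_one.1 hn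
    have hFm : F ∈ facetSets M N (2 * k + 2) ∧ r < τ F := by
      have : F ∈ ({F} : Set (Finset ℕ)) := rfl
      rwa [← hF] at this
    refine ⟨F, hFm.1.1, ?_⟩
    have hQ : {G | G ∈ facetSets M N (2 * k + 2) ∧ τ G ≤ r} =
        {G | G ∈ facetSets M N (2 * k + 2) ∧ G ≠ F} := by
      ext G
      refine and_congr_right fun hG => ?_
      have : (G ∈ facetSets M N (2 * k + 2) ∧ r < τ G) ↔ G = F := by
        rw [← Set.mem_singleton_iff, ← hF]; rfl
      rw [Ne, ← this, ← not_lt]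
      tauto
    rw [hF, hQ, hgp.commonComplex_singleton hM hN hFm.1]
  | succ n ih =>
    have hfin : {G | G ∈ facetSets M N (2 * k + 2) ∧ r < τ G}.Finite :=
      facetSets_finite.subset fun G hG => hG.1
    -- `F` is the next facet to be crossed after time `r`. At time `τ F` it no longer counts as
    -- visible, so induction applies there, and the crossing of `F` supplies the last move.
    obtain ⟨F, hF, hmin⟩ := Set.exists_min_image _ τ hfin (Set.nonempty_of_ncard_ne_zero (by omega))
    have herase : {G | G ∈ facetSets M N (2 * k + 2) ∧ τ F < τ G} =
        {G | G ∈ facetSets M N (2 * k + 2) ∧ r < τ G} \ {F} := by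
      ext G
      constructor
      · rintro ⟨hG, hlt⟩
        exact ⟨⟨hG, hF.2.trans hlt⟩, fun h => hlt.ne' (congrArg τ h)⟩
      · rintro ⟨hG, hne⟩
        exact ⟨hG.1, lt_of_le_of_ne (hmin G hG) fun h => hne (hτ hG.1 hF.1 h.symm)⟩
    have hcard : {G | G ∈ facetSets M N (2 * k + 2) ∧ τ F < τ G}.ncard = n + 1 := by
      rw [herase, Set.ncard_sdiff_singleton_of_mem hF, hn]
      rfl
    have hF0 : 0 ≤ τ F := hr.trans hF.2.le
    obtain ⟨σ, hσ, hreach⟩ := ih (τ F) hF0 hcard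
    refine ⟨σ, hσ, hreach.tail ?_⟩
    have hstep := hgp.bistellarStep (X := X (τ F)) hM h1 hN hΦ hF.1
      (by obtain ⟨c, -, h⟩ := hX (τ F) F hF.1; rw [h, sub_self, mul_zero])
      (fun G hG hne h0 => by
        obtain ⟨c, hc, h⟩ := hX (τ F) G hG
        rw [h0, zero_eq_mul, sub_eq_zero] at h
        exact h.elim hc.ne' fun h => hne (hτ hG hF.1 h))
      (by
        obtain ⟨G, hG⟩ := Set.nonempty_of_ncard_ne_zero (s := {G | G ∈ facetSets M N (2 * k + 2) ∧
          τ F < τ G}) (by omega)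
        exact ⟨G, hG.1, (hpos _ G hG.1).2 hG.2⟩)
      (hX1 _ hF0) (hnb _ hF0)
    have hmin' : ∀ G ∈ facetSets M N (2 * k + 2), (r < τ G ↔ τ F ≤ τ G) := fun G hG =>
      ⟨fun h => hmin G ⟨hG, h⟩, fun h => hF.2.trans_le h⟩
    convert hstep using 2
    · ext G
      exact and_congr_right fun hG => (hpos _ G hG).symm
    · ext G
      exact and_congr_right fun hG => by rw [← not_lt, ← not_lt, hpos _ G hG]
    · ext G
      exact and_congr_right fun hG => by rw [hmin' G hG, ← not_lt, ← hneg _ G hG, not_lt]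
    · ext G
      exact and_congr_right fun hG => by rw [hneg _ G hG, ← not_lt, hmin' G hG, not_le]

end Sweep

/-! ### The link as the border between visible and invisible facets -/

section Link

open PreAbstractSimplicialComplex

variable {M : Submodule ℝ (ℕ → ℝ)} {N F A : Finset ℕ} {D v : ℕ} {φ : ℕ → ℝ}
  {Φ : Finset ℕ → ℕ → ℝ}

/-- The ridge `A` of the polytope spanned by `N`, exposed together with `v`, lies in a facet of
the polytope spanned by the other points which is visible from `v`, and in one which is not. -/
theorem GenPos.exists_facet_erase (hgp : GenPos M N D) (hM : Module.finrank ℝ M = D + 1)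
    (hN : D + 2 ≤ N.card) (hvA : v ∉ A) (hA : A.card + 1 = D) (h : Exposes M N (insert v A) φ)
    {ε : ℝ} (hε : ε ≠ 0) :
    ∃ G ψ, A ⊆ G ∧ G.card = D ∧ Exposes M (N.erase v) G ψ ∧ ψ v = ε := by
  obtain ⟨η, hηM, hη⟩ := hgp.interpolate hM (by omega) h.sub
    (by rw [Finset.card_insert_of_notMem hvA]; omega) (fun x => if x = v then ε else 0)
  have hηv : η v = ε := by simpa using hη v (by simp)
  have hηA : ∀ i ∈ A, η i = 0 := fun i hi => by
    have hiv : i ≠ v := fun h => hvA (h ▸ hi)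
    simpa [hiv] using hη i (by simp [hi])
  have hv : v ∈ N := h.sub (Finset.mem_insert_self _ _)
  have hAN : A ⊆ N.erase v := fun x hx => Finset.mem_erase.2
    ⟨fun h => hvA (h ▸ hx), h.sub (Finset.mem_insert_of_mem hx)⟩
  have h' : Exposes M (N.erase v) A φ :=
    ⟨h.mem, hAN, fun i hi => h.zero i (Finset.mem_insert_of_mem hi), fun i hi hiA =>
      h.neg i (Finset.mem_of_mem_erase hi) fun h'' =>
        (Finset.mem_insert.1 h'').elim (Finset.ne_of_mem_erase hi) hiA⟩
  obtain ⟨s, hmem, hle, b, hb, hbA, hb0⟩ := h'.pivot (fun h'' => by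
    rw [h'', Finset.card_erase_of_mem hv] at hA; omega) hηM hηA
  -- Since `φ v = 0`, pivoting over the other points does not alter the value at `v`; the sign of
  -- `ε` thus selects a visible or an invisible facet.
  have hval : (η + s • φ) v = ε := by simp [hηv, h.zero v (Finset.mem_insert_self _ _)]
  have hex := exposes_of_nonpos hmem hle
  have hc := hgp _ hmem (fun h0 => hε (by rw [← hval, h0]; rfl)) _
    (hex.sub.trans (Finset.erase_subset _ _)) hex.zero
  have hsub : A ⊆ (N.erase v).filter fun i => (η + s • φ) i = 0 := fun x hx =>
    Finset.mem_filter.2 ⟨hAN hx, by simp [hηA x hx, h'.zero x hx]⟩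
  have hlt := Finset.card_lt_card (s := A) ⟨hsub, fun h'' =>
    hbA (h'' (Finset.mem_filter.2 ⟨hb, hb0⟩))⟩
  exact ⟨_, _, hsub, by omega, hex, hval⟩

theorem Exposes.exists_pos_smul {ψ : ℕ → ℝ} (hgp : GenPos M N D)
    (hN : D + 1 ≤ N.card) (h : Exposes M N F φ)
    (hF : F.card = D) (h' : Exposes M N F ψ) : ∃ c : ℝ, 0 < c ∧ ψ = c • φ := by
  obtain ⟨c, rfl⟩ := hgp.eq_smul hN h hF h'.mem h'.zero
  obtain ⟨b, hb, hbF⟩ := Finset.exists_mem_notMem_of_card_lt_card (s := F) (t := N) (by omega)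
  refine ⟨c, ?_, rfl⟩
  have h1 := h.neg b hb hbF
  have h2 := h'.neg b hb hbF
  simp only [Pi.smul_apply, smul_eq_mul] at h2
  by_contra hc
  nlinarith

/-- The faces of the link of `v` are those faces of the polytope spanned by the other points that
lie both in a facet visible from `v` and in an invisible one. -/
theorem GenPos.link_eq_commonComplex (hgp : GenPos M N D) (hM : Module.finrank ℝ M = D + 1)
    (hN : D + 2 ≤ N.card) (hv : v ∈ N) (K : PreAbstractSimplicialComplex ℕ)
    (hK : ∀ A, A ∈ K.faces ↔ A.Nonempty ∧ A ≠ N ∧ ∃ φ, Exposes M N A φ)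
    (hΦ : ∀ G ∈ facetSets M (N.erase v) D, Exposes M (N.erase v) G (Φ G)) :
    K.link v = commonComplex {G | G ∈ facetSets M (N.erase v) D ∧ 0 < Φ G v}
      {G | G ∈ facetSets M (N.erase v) D ∧ Φ G v < 0} := by
  have hN' : D + 1 ≤ (N.erase v).card := by rw [Finset.card_erase_of_mem hv]; omega
  have hgp' := hgp.mono (Finset.erase_subset v N)
  refine PreAbstractSimplicialComplex.ext (Set.ext fun A => ?_)
  simp only [link, commonComplex, Set.mem_ofPred_eq]
  refine and_congr_right fun hne => ⟨?_, ?_⟩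
  · rintro ⟨hvA, hA⟩
    obtain ⟨-, hAN, φ, hφ⟩ := (hK _).1 hA
    obtain ⟨F, φ', hAF, hF, hφ'⟩ := hgp.exists_facet hM (by omega) hφ
      (hgp φ hφ.mem (hφ.ne_zero hAN) _ hφ.sub hφ.zero)
    have hvF : v ∈ F := hAF (Finset.mem_insert_self _ _)
    have hAF' : A ⊆ F.erase v := fun x hx => Finset.mem_erase.2
      ⟨fun h => hvA (h ▸ hx), hAF (Finset.mem_insert_of_mem hx)⟩
    have key : ∀ ε : ℝ, ε ≠ 0 → ∃ G ∈ facetSets M (N.erase v) D, A ⊆ G ∧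
        ∃ c : ℝ, 0 < c ∧ ε = c * Φ G v := fun ε hε => by
      obtain ⟨G, ψ, hG, hGc, hψ, hψv⟩ := hgp.exists_facet_erase hM hN (Finset.notMem_erase v F)
        (by rw [Finset.card_erase_add_one hvF, hF]) (by rwa [Finset.insert_erase hvF]) hε
      have hGm : G ∈ facetSets M (N.erase v) D := ⟨hGc, ψ, hψ⟩
      obtain ⟨c, hc, hcψ⟩ := Exposes.exists_pos_smul hgp' hN' (hΦ G hGm) hGc hψ
      exact ⟨G, hGm, hAF'.trans hG, c, hc, by rw [← hψv, hcψ]; rfl⟩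
    obtain ⟨G, hG, hAG, c, hc, hcG⟩ := key 1 one_ne_zero
    obtain ⟨H, hH, hAH, d, hd, hdH⟩ := key (-1) (by norm_num)
    exact ⟨⟨G, ⟨hG, by by_contra h; nlinarith⟩, hAG⟩, H, ⟨hH, by by_contra h; nlinarith⟩, hAH⟩
  · rintro ⟨⟨G, ⟨hG, hGv⟩, hAG⟩, H, ⟨hH, hHv⟩, hAH⟩
    have hΦG := hΦ G hG
    have hΦH := hΦ H hH
    have hvA : v ∉ A := fun h => Finset.notMem_erase v N (hΦG.sub (hAG h))
    refine ⟨hvA, ?_⟩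
    -- Both coefficients are positive and chosen so that the values at `v` cancel.
    have hex : Exposes M N (insert v (G ∩ H)) ((-Φ H v) • Φ G + Φ G v • Φ H) := by
      refine ⟨M.add_mem (M.smul_mem _ hΦG.mem) (M.smul_mem _ hΦH.mem),
        Finset.insert_subset hv fun x hx => Finset.mem_of_mem_erase
          (hΦG.sub (Finset.mem_inter.1 hx).1), fun i hi => ?_, fun i hi hi' => ?_⟩
      · rcases Finset.mem_insert.1 hi with rfl | hi
        · simp only [Pi.add_apply, Pi.smul_apply, smul_eq_mul]
          ring
        · rw [Finset.mem_inter] at hi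
          simp [hΦG.zero i hi.1, hΦH.zero i hi.2]
      · rw [Finset.mem_insert, not_or, Finset.mem_inter, not_and_or] at hi'
        have hi'' := Finset.mem_erase.2 ⟨hi'.1, hi⟩
        have h1 := hΦG.nonpos hi''
        have h2 := hΦH.nonpos hi''
        simp only [Pi.add_apply, Pi.smul_apply, smul_eq_mul]
        rcases hi'.2 with h3 | h3
        · have := hΦG.neg i hi'' h3
          nlinarith
        · have := hΦH.neg i hi'' h3
          nlinarith
    have hmem : insert v (G ∩ H) ∈ K.faces := (hK _).2 ⟨Finset.insert_nonempty _ _, fun h => by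
      have h2 := congrArg Finset.card h
      have h3 := Finset.card_insert_le v (G ∩ H)
      have h4 := Finset.card_le_card (Finset.inter_subset_left (s₁ := G) (s₂ := H))
      have := hG.1
      omega, _, hex⟩
    exact (K.isRelLowerSet_faces hmem).2
      (Finset.insert_subset_insert v (Finset.subset_inter hAG hAH)) (Finset.insert_nonempty _ _)

end Link

/-! ### Stellated links, dimension and connectedness -/

section ExposedComplex

open PreAbstractSimplicialComplex

variable {M : Submodule ℝ (ℕ → ℝ)} {N : Finset ℕ} {k v : ℕ} {K : PreAbstractSimplicialComplex ℕ}

theorem GenPos.link_eq_simplexBoundary {D : ℕ} (hgp : GenPos M N D)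
    (hM : Module.finrank ℝ M = D + 1) (hN : N.card = D + 1) (hv : v ∈ N)
    (hK : ∀ A, A ∈ K.faces ↔ A.Nonempty ∧ A ≠ N ∧ ∃ φ, Exposes M N A φ) :
    K.link v = simplexBoundary (N.erase v) := by
  refine PreAbstractSimplicialComplex.ext (Set.ext fun A => ?_)
  simp only [link, simplexBoundary, Set.mem_ofPred_eq, hK, Finset.insert_nonempty, true_and]
  refine and_congr_right fun hne => ⟨?_, fun hA => ?_⟩
  · rintro ⟨hvA, hAN, φ, hφ⟩
    have hsub : A ⊆ N.erase v := fun x hx => Finset.mem_erase.2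
      ⟨fun h => hvA (h ▸ hx), hφ.sub (Finset.mem_insert_of_mem hx)⟩
    exact hsub.ssubset_of_ne fun h => hAN (by rw [h, Finset.insert_erase hv])
  · have hvA : v ∉ A := fun h => Finset.notMem_erase v N (hA.1 h)
    have hsub : insert v A ⊆ N :=
      Finset.insert_subset hv (hA.1.trans (Finset.erase_subset _ _))
    refine ⟨hvA, fun h => hA.ne (by rw [← h, Finset.erase_insert hvA]), ?_⟩
    obtain ⟨φ, hφM, hφ⟩ := hgp.interpolate hM hN.ge Finset.Subset.rfl hN.le
      (fun x => if x ∈ insert v A then 0 else -1)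
    refine ⟨φ, hφM, hsub, fun i hi => ?_, fun i hi hiA => ?_⟩
    · rw [hφ i (hsub hi), if_pos hi]
    · rw [hφ i hi, if_neg hiA]
      norm_num

/-- Links of vertices in a `k + 1`-neighbourly polytopal sphere arise from the boundary of a
simplex by bistellar moves of index less than `k`. -/
theorem GenPos.link_reachable (hgp : GenPos M N (2 * k + 2))
    (hM : Module.finrank ℝ M = 2 * k + 3) (h1 : (1 : ℕ → ℝ) ∈ M) (hN : 2 * k + 3 ≤ N.card)
    (hv : v ∈ N) (hK : ∀ A, A ∈ K.faces ↔ A.Nonempty ∧ A ≠ N ∧ ∃ φ, Exposes M N A φ)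
    (hnb : ∀ A ⊆ N, A.card ≤ k + 1 → ∃ φ, Exposes M N A φ) :
    ∃ σ : Finset ℕ, σ.card = 2 * k + 2 ∧
      Relation.ReflTransGen (BistellarStep (2 * k) k) (simplexBoundary σ) (K.link v) := by
  have hcardN' : (N.erase v).card = N.card - 1 := Finset.card_erase_of_mem hv
  -- With `2k + 3` vertices the polytope is a simplex; deleting `v` would leave too few points for
  -- the sweep.
  rcases hN.eq_or_lt with hN | hN
  · refine ⟨N.erase v, by omega, ?_⟩
    rw [hgp.link_eq_simplexBoundary hM hN.symm hv hK]
  have hex : ∀ G, ∃ φ, G ∈ facetSets M (N.erase v) (2 * k + 2) → Exposes M (N.erase v) G φ := by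
    intro G
    by_cases hG : G ∈ facetSets M (N.erase v) (2 * k + 2)
    · exact hG.2.imp fun φ hφ _ => hφ
    · exact ⟨0, fun h => absurd h hG⟩
  choose Φ hΦ using hex
  have hgp' := hgp.mono (Finset.erase_subset v N)
  have hΦne : ∀ G ∈ facetSets M (N.erase v) (2 * k + 2), ∃ b ∈ N.erase v, Φ G b < 0 := by
    intro G hG
    have := hG.1
    obtain ⟨b, hb, hbG⟩ := Finset.exists_mem_notMem_of_card_lt_card (s := G) (t := N.erase v)
      (by omega)
    exact ⟨b, hb, (hΦ G hG).neg b hb hbG⟩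
  have hΦv : ∀ G ∈ facetSets M (N.erase v) (2 * k + 2), Φ G v ≠ 0 := by
    intro G hG h0
    obtain ⟨b, -, hb⟩ := hΦne G hG
    have hvG : v ∉ G := fun h => Finset.notMem_erase v N ((hΦ G hG).sub h)
    have := hgp (Φ G) (hΦ G hG).mem (fun h => hb.ne (congrFun h b)) (insert v G)
      (Finset.insert_subset hv ((hΦ G hG).sub.trans (Finset.erase_subset _ _)))
      (fun i hi => (Finset.mem_insert.1 hi).elim (fun h => h ▸ h0) ((hΦ G hG).zero i))
    rw [Finset.card_insert_of_notMem hvG, hG.1] at this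
    omega
  -- These functionals, evaluated at the weighted sum of the points, compare the crossing times of
  -- `F` and `G`; generic weights make the times distinct.
  have hfin : (Set.image2 (fun F G => Φ F v • Φ G - Φ G v • Φ F)
      (facetSets M (N.erase v) (2 * k + 2)) (facetSets M (N.erase v) (2 * k + 2)) \ {0}).Finite :=
    (Set.Finite.image2 _ facetSets_finite facetSets_finite).sdiff
  obtain ⟨w, hw, hgen⟩ := exists_generic_weights (N.erase v) hfin.toFinset (by
    intro φ hφ
    rw [Set.Finite.mem_toFinset] at hφ
    obtain ⟨⟨F, hF, G, hG, rfl⟩, hne⟩ := hφ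
    by_contra! hall
    have := hgp' _ (M.sub_mem (M.smul_mem _ (hΦ G hG).mem) (M.smul_mem _ (hΦ F hF).mem)) hne _
      Finset.Subset.rfl hall
    omega)
  set d : Finset ℕ → ℝ := fun G => -∑ i ∈ N.erase v, w i * Φ G i with hd
  have hdpos : ∀ G ∈ facetSets M (N.erase v) (2 * k + 2), 0 < d G := by
    intro G hG
    obtain ⟨b, hb, hneg⟩ := hΦne G hG
    rw [hd, neg_pos]
    exact Finset.sum_neg' (fun i hi => mul_nonpos_of_nonneg_of_nonpos (hw i).le
      ((hΦ G hG).nonpos hi)) ⟨b, hb, mul_neg_of_pos_of_neg (hw b) hneg⟩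
  -- In homogeneous coordinates this is the point `v + r ∑ w i • i`, so `X r (Φ G) = d G * (Φ G v /
  -- d G - r)`, and the facet `G` is crossed at time `Φ G v / d G`.
  let X : ℝ → (ℕ → ℝ) →ₗ[ℝ] ℝ := fun r =>
    LinearMap.proj v + r • ∑ i ∈ N.erase v, w i • LinearMap.proj i
  have hXapp : ∀ r φ, X r φ = φ v + r * ∑ i ∈ N.erase v, w i * φ i := fun r φ => by
    simp [X, LinearMap.sum_apply]
  have hτinj : Set.InjOn (fun G => Φ G v / d G) (facetSets M (N.erase v) (2 * k + 2)) := by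
    intro F hF G hG hFG
    by_contra hne
    have hF0 := (hdpos F hF).ne'
    have hG0 := (hdpos G hG).ne'
    simp only [div_eq_div_iff hF0 hG0] at hFG
    have hcard : ¬ G ⊆ F := fun h =>
      hne (Finset.eq_of_subset_of_card_le h (by rw [hF.1, hG.1])).symm
    obtain ⟨b, hbG, hbF⟩ := Finset.not_subset.1 hcard
    refine hgen (Φ F v • Φ G - Φ G v • Φ F) ?_ ?_
    · rw [Set.Finite.mem_toFinset]
      refine ⟨⟨F, hF, G, hG, rfl⟩, fun h => ?_⟩
      have h2 := congrFun (Set.mem_singleton_iff.1 h) b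
      simp only [Pi.sub_apply, Pi.smul_apply, smul_eq_mul, (hΦ G hG).zero b hbG, mul_zero,
        zero_sub, Pi.zero_apply, neg_eq_zero, mul_eq_zero] at h2
      exact h2.elim (hΦv G hG) ((hΦ F hF).neg b ((hΦ G hG).sub hbG) hbF).ne
    · have : ∑ i ∈ N.erase v, w i * (Φ F v • Φ G - Φ G v • Φ F) i =
          Φ G v * d F - Φ F v * d G := by
        simp only [hd, Pi.sub_apply, Pi.smul_apply, smul_eq_mul, mul_neg, Finset.mul_sum,
          sub_neg_eq_add,
          neg_add_eq_sub, ← Finset.sum_sub_distrib]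
        exact Finset.sum_congr rfl fun i _ => by ring
      rw [this, hFG, sub_self]
  have hpos : ∀ G ∈ facetSets M (N.erase v) (2 * k + 2), (0 < Φ G v / d G ↔ 0 < Φ G v) :=
    fun G hG => div_pos_iff_of_pos_right (hdpos G hG)
  have hlink : K.link v = commonComplex
      {G | G ∈ facetSets M (N.erase v) (2 * k + 2) ∧ 0 < Φ G v / d G}
      {G | G ∈ facetSets M (N.erase v) (2 * k + 2) ∧ Φ G v / d G ≤ 0} := by
    rw [hgp.link_eq_commonComplex hM (by omega) hv K hK hΦ]
    congr 1
    · ext G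
      exact and_congr_right fun hG => (hpos G hG).symm
    · ext G
      refine and_congr_right fun hG => ?_
      rw [← not_lt, hpos G hG, not_lt]
      exact ⟨fun h => h.le, fun h => lt_of_le_of_ne h (hΦv G hG)⟩
  -- A facet through `v` gives a face of the link, which by `hlink` lies in a visible facet.
  have hvis : {G | G ∈ facetSets M (N.erase v) (2 * k + 2) ∧ 0 < Φ G v / d G}.Nonempty := by
    obtain ⟨φ, hφ⟩ := hnb {v} (by simpa using hv) (by simp)
    obtain ⟨F, φ', hvF, hF, hφ'⟩ := hgp.exists_facet hM (by omega) hφ (by simp)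
    rw [Finset.singleton_subset_iff] at hvF
    have hmem : F.erase v ∈ (K.link v).faces := by
      refine ⟨Finset.card_pos.1 ?_, Finset.notMem_erase v F, ?_⟩
      · rw [Finset.card_erase_of_mem hvF]
        omega
      · rw [Finset.insert_erase hvF, hK]
        exact ⟨⟨v, hvF⟩, fun h => by rw [← h] at hN; omega, φ', hφ'⟩
    rw [hlink] at hmem
    obtain ⟨-, ⟨G, hG, -⟩, -⟩ := hmem
    exact ⟨G, hG⟩
  have hvisfin : {G | G ∈ facetSets M (N.erase v) (2 * k + 2) ∧ 0 < Φ G v / d G}.Finite :=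
    facetSets_finite.subset fun G hG => hG.1
  obtain ⟨n, hn⟩ := Nat.exists_eq_succ_of_ne_zero ((Set.ncard_pos hvisfin).2 hvis).ne'
  rw [hlink]
  refine hgp'.reachable hM h1 (by omega) hΦ _ hτinj X (fun r G hG => ⟨d G, hdpos G hG, ?_⟩)
    (fun r hr => ?_) (fun r hr A hA hAc => ?_) n 0 le_rfl hn
  · have := (hdpos G hG).ne'
    rw [hXapp, mul_sub, mul_div_cancel₀ _ this, hd]
    ring
  · rw [hXapp]
    have : 0 ≤ ∑ i ∈ N.erase v, w i * (1 : ℕ → ℝ) i :=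
      Finset.sum_nonneg fun i _ => by simpa using (hw i).le
    have := mul_nonneg hr this
    simp only [Pi.one_apply] at *
    linarith
  · obtain ⟨φ, hφ⟩ := hnb A (hA.trans (Finset.erase_subset _ _)) hAc
    have hvA : v ∉ A := fun h => Finset.notMem_erase v N (hA h)
    refine ⟨φ, ⟨hφ.mem, hA, hφ.zero, fun i hi => hφ.neg i (Finset.mem_of_mem_erase hi)⟩, ?_⟩
    rw [hXapp]
    have : ∑ i ∈ N.erase v, w i * φ i ≤ 0 := Finset.sum_nonpos fun i hi =>
      mul_nonpos_of_nonneg_of_nonpos (hw i).le (hφ.nonpos (Finset.mem_of_mem_erase hi))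
    have := mul_nonpos_of_nonneg_of_nonpos hr this
    have := hφ.neg v hv hvA
    linarith

theorem GenPos.hasDim {D : ℕ} (hgp : GenPos M N (D + 1)) (hM : Module.finrank ℝ M = D + 2)
    (hN : D + 2 ≤ N.card) (hK : ∀ A, A ∈ K.faces ↔ A.Nonempty ∧ A ≠ N ∧ ∃ φ, Exposes M N A φ)
    (hKne : K.faces.Nonempty) : K.HasDim D := by
  have hcard : ∀ A ∈ K.faces, A.card ≤ D + 1 := fun A hA => by
    obtain ⟨-, hAN, φ, hφ⟩ := (hK A).1 hA
    exact hgp φ hφ.mem (hφ.ne_zero hAN) A hφ.sub hφ.zero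
  refine ⟨hcard, ?_⟩
  obtain ⟨A, hA⟩ := hKne
  obtain ⟨hne, -, φ, hφ⟩ := (hK A).1 hA
  obtain ⟨F, φ', hAF, hF, hφ'⟩ := hgp.exists_facet hM hN hφ (hcard A hA)
  exact ⟨F, (hK F).2 ⟨hne.mono hAF, fun h => by rw [← h] at hN; omega, φ', hφ'⟩, hF⟩

/-- Pivot `g - g v` about the vertex `v`. Nonpositivity at `m` forces `s > 0`, so a new zero `b`
satisfies `g b - g v = -s * φ b > 0`; the zero set is a face containing `v` and `b`. -/
theorem GenPos.exists_edge_increasing {D m : ℕ} (hgp : GenPos M N (D + 2))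
    (hM : Module.finrank ℝ M = D + 3) (h1 : (1 : ℕ → ℝ) ∈ M) (hN : D + 3 ≤ N.card)
    (hK : ∀ A, A ∈ K.faces ↔ A.Nonempty ∧ A ≠ N ∧ ∃ φ, Exposes M N A φ)
    {g φ : ℕ → ℝ} (hg : Exposes M N {m} g) (hφ : Exposes M N {v} φ) (hvm : v ≠ m) :
    ∃ b ∈ N, b ≠ v ∧ g v < g b ∧ {v, b} ∈ K.faces := by
  have hv : v ∈ N := by simpa using hφ.sub
  have hm : m ∈ N := by simpa using hg.sub
  have hgm : g m = 0 := hg.zero m (by simp)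
  have hgv : g v < 0 := hg.neg v hv (by simpa using hvm)
  have hφm : φ m < 0 := hφ.neg m hm (by simpa using hvm.symm)
  have hφv : φ v = 0 := hφ.zero v (by simp)
  have hψM : g - g v • (1 : ℕ → ℝ) ∈ M := M.sub_mem hg.mem (M.smul_mem _ h1)
  obtain ⟨s, hmem, hle, b, hb, hbv, hb0⟩ := hφ.pivot
    (fun h => by rw [← h] at hN; simp at hN) hψM (by simp)
  have happ : ∀ i, (g - g v • (1 : ℕ → ℝ) + s • φ) i = g i - g v + s * φ i := fun i => by simp
  simp only [happ] at hle hb0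
  have hs : 0 < s := by
    have := hle m hm
    by_contra hs
    nlinarith [mul_nonneg_of_nonpos_of_nonpos (not_lt.1 hs) hφm.le]
  rw [Finset.mem_singleton] at hbv
  have hface : ∀ {F : Finset ℕ} {φ' : ℕ → ℝ} {x : ℕ}, F ≠ N → Exposes M N F φ' → v ∈ F → x ∈ F →
      {v, x} ∈ K.faces := fun {F φ' x} hFN hF hvF hxF =>
    (K.isRelLowerSet_faces ((hK F).2 ⟨⟨v, hvF⟩, hFN, φ', hF⟩)).2
      (Finset.insert_subset hvF (Finset.singleton_subset_iff.2 hxF)) (Finset.insert_nonempty _ _)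
  -- If the pivoted functional vanishes on all of `N`, it exposes no proper face; but then `g - g v
  -- = -s * φ` on `N`, and every neighbour of `v` has a larger value.
  by_cases hzero : ∀ i ∈ N, g i - g v + s * φ i = 0
  · obtain ⟨F, φ', hvF, hF, hφ'⟩ := hgp.exists_facet hM hN hφ (by simp)
    rw [Finset.singleton_subset_iff] at hvF
    obtain ⟨c, hc, hcv⟩ := Finset.exists_mem_ne (show 1 < F.card by omega) v
    have hcN := hφ'.sub hc
    refine ⟨c, hcN, hcv, ?_, hface (fun h => by rw [← h] at hN; omega) hφ' hvF hc⟩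
    have := hφ.neg c hcN (by simpa using hcv)
    nlinarith [hzero c hcN]
  · push Not at hzero
    obtain ⟨i, hi, hne⟩ := hzero
    refine ⟨b, hb, hbv, ?_, hface (fun h => hne ?_)
      (exposes_of_nonpos hmem (by simpa only [happ])) ?_ ?_⟩
    · have := hφ.neg b hb (by simpa using hbv)
      nlinarith
    · rw [← h, Finset.mem_filter, happ] at hi
      exact hi.2
    · rw [Finset.mem_filter, happ, hφv]
      exact ⟨hv, by ring⟩
    · rw [Finset.mem_filter, happ]
      exact ⟨hb, hb0⟩

theorem GenPos.isConnected {D : ℕ} (hgp : GenPos M N (D + 2))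
    (hM : Module.finrank ℝ M = D + 3) (h1 : (1 : ℕ → ℝ) ∈ M) (hN : D + 3 ≤ N.card)
    (hK : ∀ A, A ∈ K.faces ↔ A.Nonempty ∧ A ≠ N ∧ ∃ φ, Exposes M N A φ)
    (hvert : ∀ v ∈ N, {v} ∈ K.faces) : K.IsConnected := by
  have hKN : ∀ v, {v} ∈ K.faces → v ∈ N ∧ ∃ φ, Exposes M N {v} φ := fun v hv => by
    obtain ⟨-, -, φ, hφ⟩ := (hK _).1 hv
    exact ⟨by simpa using hφ.sub, φ, hφ⟩
  obtain ⟨m, hm⟩ : N.Nonempty := Finset.card_pos.1 (by omega)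
  obtain ⟨-, g, hg⟩ := hKN m (hvert m hm)
  -- Induction on the number of points with a larger value of `g`.
  have hreach : ∀ n : ℕ, ∀ v : {v : ℕ // {v} ∈ K.faces}, (N.filter fun i => g v < g i).card = n →
      K.edgeGraph.Reachable v ⟨m, hvert m hm⟩ := by
    intro n
    induction n using Nat.strong_induction_on with
    | _ n ih =>
      intro v hn
      by_cases hvm : (v : ℕ) = m
      · rw [show v = ⟨m, hvert m hm⟩ from Subtype.ext hvm]
      obtain ⟨-, φ, hφ⟩ := hKN v v.2
      obtain ⟨b, hb, hbv, hlt, hface⟩ := hgp.exists_edge_increasing hM h1 hN hK hg hφ hvm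
      have hadj : K.edgeGraph.Adj v ⟨b, hvert b hb⟩ :=
        ⟨fun h => hbv (congrArg Subtype.val h).symm, hface⟩
      refine hadj.reachable.trans (ih _ ?_ ⟨b, hvert b hb⟩ rfl)
      rw [← hn]
      refine Finset.card_lt_card ⟨fun i hi => ?_, fun h => ?_⟩
      · rw [Finset.mem_filter] at hi ⊢
        exact ⟨hi.1, hlt.trans hi.2⟩
      · exact lt_irrefl _ (Finset.mem_filter.1 (h (Finset.mem_filter.2 ⟨hb, hlt⟩))).2
  have : Nonempty {v : ℕ // {v} ∈ K.faces} := ⟨⟨m, hvert m hm⟩⟩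
  exact ⟨fun u v => (hreach _ u rfl).trans (hreach _ v rfl).symm⟩

end ExposedComplex

/-! ### Vertices and faces of a polytope -/

section PolytopeFaces

variable {E : Type*} [NormedAddCommGroup E] [NormedSpace ℝ E]

/-- A point of the convex hull of `V` at which a functional attains its maximum is a convex
combination of points of `V` at which it does. -/
theorem mem_convexHull_filter_of_le [DecidableEq E] {V : Finset E} {f : E →ₗ[ℝ] ℝ} {c : ℝ}
    (hV : ∀ p ∈ V, f p ≤ c) {x : E} (hx : x ∈ convexHull ℝ (V : Set E)) (hc : c ≤ f x) :
    x ∈ convexHull ℝ ((V.filter fun p => f p = c : Finset E) : Set E) := by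
  obtain ⟨w, hw, hw1, rfl⟩ := Finset.mem_convexHull'.1 hx
  have hsum : ∑ p ∈ V, w p * (c - f p) ≤ 0 := by
    simp only [mul_sub, Finset.sum_sub_distrib, ← Finset.sum_mul, hw1, one_mul]
    simpa using hc
  have hz := (Finset.sum_eq_zero_iff_of_nonneg fun p hp =>
    mul_nonneg (hw p hp) (sub_nonneg.2 (hV p hp))).1 (hsum.antisymm (Finset.sum_nonneg fun p hp =>
      mul_nonneg (hw p hp) (sub_nonneg.2 (hV p hp))))
  have hw0 : ∀ p ∈ V, ¬ f p = c → w p = 0 := fun p hp hne =>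
    (mul_eq_zero.1 (hz p hp)).resolve_right fun h => hne (sub_eq_zero.1 h).symm
  refine Finset.mem_convexHull'.2 ⟨w, fun p hp => hw p (Finset.mem_filter.1 hp).1, ?_, ?_⟩
  · rw [← hw1, Finset.sum_filter_of_ne]
    exact fun p hp hne => by_contra fun h => hne (hw0 p hp h)
  · rw [Finset.sum_filter_of_ne]
    exact fun p hp hne => by_contra fun h => hne (by rw [hw0 p hp h, zero_smul])

theorem le_of_mem_convexHull {s : Set E} {f : E →ₗ[ℝ] ℝ} {c : ℝ} (hs : ∀ p ∈ s, f p ≤ c) {x : E}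
    (hx : x ∈ convexHull ℝ s) : f x ≤ c :=
  convexHull_min (t := {x | f x ≤ c}) hs (convex_halfSpace_le f.isLinear c) hx

/-- A polytope is the convex hull of its exposed points, of which there are finitely many. -/
theorem exists_finset_exposedPoints [DecidableEq E] (s : Finset E) :
    ∃ V : Finset E, (V : Set E) = (convexHull ℝ (s : Set E)).exposedPoints ℝ ∧
      convexHull ℝ (s : Set E) = convexHull ℝ (V : Set E) := by
  induction s using Finset.strongInduction with
  | H s ih =>
    -- Redundant points are discarded. Once none is left, a functional separating `p` from the hull
    -- of the others attains its maximum only at `p`.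
    by_cases hs : ∃ p ∈ s, p ∈ convexHull ℝ (s.erase p : Set E)
    · obtain ⟨p, hp, hpc⟩ := hs
      have heq : convexHull ℝ (s : Set E) = convexHull ℝ ((s.erase p : Finset E) : Set E) := by
        refine Set.Subset.antisymm (convexHull_min (fun x hx => ?_) (convex_convexHull _ _))
          (convexHull_mono (by exact_mod_cast Finset.erase_subset _ _))
        by_cases hxp : x = p
        · exact hxp ▸ hpc
        · exact subset_convexHull _ _ (Finset.mem_coe.2 (Finset.mem_erase.2 ⟨hxp, hx⟩))
      rw [heq]
      exact ih _ (Finset.erase_ssubset hp)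
    · push Not at hs
      refine ⟨s, Set.Subset.antisymm (fun p hp => ?_) (exposedPoints_subset_extremePoints.trans
        extremePoints_convexHull_subset), rfl⟩
      obtain ⟨f, u, hf, hu⟩ := geometric_hahn_banach_closed_point (convex_convexHull ℝ _)
        ((s.erase p).finite_toSet.isClosed_convexHull ℝ) (hs p hp)
      have hmax : ∀ q ∈ s, f q ≤ f p := fun q hq => by
        by_cases hqp : q = p
        · rw [hqp]
        · exact ((hf q (subset_convexHull _ _ (Finset.mem_coe.2
            (Finset.mem_erase.2 ⟨hqp, hq⟩)))).trans hu).le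
      refine ⟨subset_convexHull _ _ hp, f, fun y hy =>
        ⟨le_of_mem_convexHull (f := f.toLinearMap) hmax hy, fun hle => ?_⟩⟩
      have h2 := mem_convexHull_filter_of_le (f := f.toLinearMap) hmax hy hle
      have h3 : (s.filter fun q => f.toLinearMap q = f p) = {p} := by
        ext q
        simp only [Finset.mem_filter, Finset.mem_singleton]
        refine ⟨fun hq => ?_, by rintro rfl; exact ⟨hp, rfl⟩⟩
        by_contra hqp
        exact ((hf q (subset_convexHull _ _ (Finset.mem_coe.2
          (Finset.mem_erase.2 ⟨hqp, hq.1⟩)))).trans hu).ne hq.2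
      rw [h3] at h2
      simpa using h2

end PolytopeFaces

/-- The faces of a polytope are the sets of vertices exposed by affine functionals. -/
theorem mem_boundaryFaces_iff {n : ℕ} {V B : Finset (EuclideanSpace ℝ (Fin n))}
    (hV : (V : Set (EuclideanSpace ℝ (Fin n))) =
      (convexHull ℝ (V : Set (EuclideanSpace ℝ (Fin n)))).exposedPoints ℝ) (hB : B.Nonempty)
    (hBV : B ⊆ V) :
    B ∈ boundaryFaces (convexHull ℝ (V : Set (EuclideanSpace ℝ (Fin n)))) ↔ B ≠ V ∧
      ∃ (l : EuclideanSpace ℝ (Fin n) →ₗ[ℝ] ℝ) (c : ℝ), (∀ x ∈ B, l x + c = 0) ∧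
        ∀ x ∈ V, x ∉ B → l x + c < 0 := by
  classical
  constructor
  · rintro ⟨-, -, hexp, hne⟩
    refine ⟨fun h => hne (by rw [h]), ?_⟩
    obtain ⟨b, hb⟩ := hB
    have hBc : ∀ x ∈ B, x ∈ convexHull ℝ (B : Set (EuclideanSpace ℝ (Fin n))) := fun x hx =>
      subset_convexHull _ _ hx
    obtain ⟨l, hl⟩ := hexp ⟨b, hBc b hb⟩
    have hBl := fun x hx => (Set.ext_iff.1 hl x).1 (hBc x hx)
    refine ⟨l.toLinearMap, -l b, fun x hx => ?_, fun x hx hxB => ?_⟩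
    · have h1 := (hBl x hx).2 b (hBl b hb).1
      have h2 := (hBl b hb).2 x (hBl x hx).1
      simp only [ContinuousLinearMap.coe_coe]
      linarith
    · have hxP : x ∈ convexHull ℝ (V : Set (EuclideanSpace ℝ (Fin n))) := subset_convexHull _ _ hx
      have h1 := (hBl b hb).2 x hxP
      -- Otherwise `x` lies in the hull of `B`. The functional exposing the vertex `x` attains its
      -- maximum over `B` at some `y` and is no larger at `x`, so `y = x`, contradicting `x ∉ B`.
      have h2 : l x ≠ l b := by
        intro h2
        have hxc : x ∈ convexHull ℝ (B : Set (EuclideanSpace ℝ (Fin n))) := by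
          rw [hl]
          exact ⟨hxP, fun y hy => h2 ▸ (hBl b hb).2 y hy⟩
        have hx' := hx
        rw [← Finset.mem_coe, hV] at hx'
        obtain ⟨-, l', hl'⟩ := hx'
        obtain ⟨y, hy, hmax⟩ := B.exists_max_image l' ⟨b, hb⟩
        have h3 := le_of_mem_convexHull (f := l'.toLinearMap) hmax hxc
        have h4 := (hl' y (subset_convexHull _ _ (hBV hy))).2 h3
        exact hxB (h4 ▸ hy)
      have := lt_of_le_of_ne h1 h2
      simp only [ContinuousLinearMap.coe_coe]
      linarith
  · rintro ⟨hne, l, c, hzero, hneg⟩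
    have hle : ∀ x ∈ V, l x ≤ -c := fun x hx => by
      by_cases hxB : x ∈ B
      · linarith [hzero x hxB]
      · linarith [hneg x hx hxB]
    have hfilter : (V.filter fun x => l x = -c) = B := by
      ext x
      rw [Finset.mem_filter]
      refine ⟨fun hx => ?_, fun hx => ⟨hBV hx, by linarith [hzero x hx]⟩⟩
      by_contra hxB
      linarith [hneg x hx.1 hxB]
    have hBeq : ∀ x ∈ convexHull ℝ (B : Set (EuclideanSpace ℝ (Fin n))), l x = -c := fun x hx =>
      convexHull_min (t := {x | l x = -c}) (fun x hx => by
        have := hzero x hx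
        simp only [Set.mem_ofPred_eq]
        linarith)
        (convex_hyperplane l.isLinear _) hx
    refine ⟨hB, hV ▸ Finset.coe_subset.2 hBV, fun _ => ⟨LinearMap.toContinuousLinearMap l, ?_⟩, ?_⟩
    · ext x
      simp only [LinearMap.coe_toContinuousLinearMap', Set.mem_ofPred_eq]
      constructor
      · intro hx
        refine ⟨convexHull_mono (Finset.coe_subset.2 hBV) hx, fun y hy => ?_⟩
        rw [hBeq x hx]
        exact le_of_mem_convexHull hle hy
      · rintro ⟨hx, hmax⟩
        obtain ⟨b, hb⟩ := hB
        have := mem_convexHull_filter_of_le hle hx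
          (by have := hmax b (subset_convexHull _ _ (hBV hb)); linarith [hzero b hb])
        rwa [hfilter] at this
    · intro heq
      obtain ⟨x, hx, hxB⟩ := Finset.exists_of_ssubset (hBV.ssubset_of_ne hne)
      have h1 : x ∈ convexHull ℝ (V : Set (EuclideanSpace ℝ (Fin n))) := subset_convexHull _ _ hx
      rw [← heq] at h1
      linarith [hBeq x h1, hneg x hx hxB]

/-! ### The space of values of affine functions -/

section AffineValues

variable {E : Type*} [AddCommGroup E] [Module ℝ E]

/-- The functional values of affine functions at a sequence of points. -/
def affineValues (p : ℕ → E) :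
    (vectorSpan ℝ (Set.range p) →ₗ[ℝ] ℝ) × ℝ →ₗ[ℝ] (ℕ → ℝ) where
  toFun x i := x.1 ⟨p i -ᵥ p 0, vsub_mem_vectorSpan ℝ ⟨i, rfl⟩ ⟨0, rfl⟩⟩ + x.2
  map_add' x y := by ext i; simp; ring
  map_smul' c x := by ext i; simp; ring

theorem mem_range_affineValues {p : ℕ → E} {φ : ℕ → ℝ} :
    φ ∈ LinearMap.range (affineValues p) ↔
      ∃ (l : E →ₗ[ℝ] ℝ) (c : ℝ), ∀ i, φ i = l (p i) + c := by
  constructor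
  · rintro ⟨⟨l, c⟩, rfl⟩
    obtain ⟨L, hL⟩ := LinearMap.exists_extend l
    refine ⟨L, c - L (p 0), fun i => ?_⟩
    simp only [affineValues, ← hL, LinearMap.coe_mk, AddHom.coe_mk, LinearMap.comp_apply,
      Submodule.subtype_apply, vsub_eq_sub, map_sub]
    ring
  · rintro ⟨l, c, h⟩
    refine ⟨⟨l ∘ₗ Submodule.subtype _, c + l (p 0)⟩, funext fun i => ?_⟩
    simp only [affineValues, h i, LinearMap.coe_mk, AddHom.coe_mk, LinearMap.comp_apply,
      Submodule.subtype_apply, vsub_eq_sub, map_sub]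
    ring

/-- The linear parts live on the direction space spanned by the points, not on `E`, so a function
vanishing at all points is zero; this gives `M` one dimension more than the polytope. -/
theorem affineValues_injective (p : ℕ → E) : Function.Injective (affineValues p) := by
  rw [← LinearMap.ker_eq_bot, LinearMap.ker_eq_bot']
  rintro ⟨l, c⟩ h
  obtain ⟨L, hL⟩ := LinearMap.exists_extend l
  have h' : ∀ i, L (p i -ᵥ p 0) + c = 0 := fun i => by
    have := congrFun h i
    simpa [affineValues, ← hL] using this
  have hc : c = 0 := by simpa using h' 0
  have hker : vectorSpan ℝ (Set.range p) ≤ LinearMap.ker L := by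
    rw [vectorSpan_range_eq_span_range_vsub_right ℝ p 0, Submodule.span_le]
    rintro _ ⟨i, rfl⟩
    simpa [hc] using h' i
  refine Prod.ext (LinearMap.ext fun x => ?_) hc
  rw [← hL]
  exact hker x.2

theorem finrank_range_affineValues [FiniteDimensional ℝ E] (p : ℕ → E) :
    Module.finrank ℝ (LinearMap.range (affineValues p)) =
      Module.finrank ℝ (vectorSpan ℝ (Set.range p)) + 1 := by
  rw [LinearMap.finrank_range_of_inj (affineValues_injective p), Module.finrank_prod,
    Module.finrank_linearMap, Module.finrank_self, mul_one]

end AffineValues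

/-! ### Transport along relabellings of the vertices -/

namespace PreAbstractSimplicialComplex

theorem singleton_mem_faces {V : Type*} {S : PreAbstractSimplicialComplex V} {A : Finset V}
    (hA : A ∈ S.faces) {v : V} (hv : v ∈ A) :
    {v} ∈ S.faces :=
  (S.isRelLowerSet_faces hA).2 (Finset.singleton_subset_iff.2 hv) (Finset.singleton_nonempty v)

variable {V W : Type*} [DecidableEq W] {S : PreAbstractSimplicialComplex V}
  {f : V → W}

theorem image_mem_map_faces_iff (hf : Set.InjOn f {v | {v} ∈ S.faces}) {A : Finset V}
    (hA : ∀ v ∈ A, {v} ∈ S.faces) : A.image f ∈ (S.map f).faces ↔ A ∈ S.faces := by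
  refine ⟨fun h => ?_, fun h => ⟨A, h, rfl⟩⟩
  obtain ⟨A', hA', heq⟩ := h
  have : A' = A := by
    have h2 : f '' (A' : Set V) = f '' (A : Set V) := by
      rw [← Finset.coe_image, ← Finset.coe_image]
      exact congrArg _ heq
    exact Finset.coe_injective ((hf.image_eq_image_iff
      (fun v hv => singleton_mem_faces hA' hv) hA).1 h2)
  exact this ▸ hA'

theorem card_image_of_mem_faces (hf : Set.InjOn f {v | {v} ∈ S.faces}) {A : Finset V}
    (hA : A ∈ S.faces) : (A.image f).card = A.card :=
  Finset.card_image_of_injOn (hf.mono fun _ hv => singleton_mem_faces hA hv)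

theorem finite_of_map (hf : Set.InjOn f {v | {v} ∈ S.faces}) (h : (S.map f).faces.Finite) :
    S.faces.Finite := by
  refine Set.Finite.of_injOn (f := fun A => A.image f) (t := (S.map f).faces)
    (fun A hA => ⟨A, hA, rfl⟩) ?_ h
  intro A hA B hB heq
  have h2 : f '' (A : Set V) = f '' (B : Set V) := by
    rw [← Finset.coe_image, ← Finset.coe_image]
    exact congrArg _ heq
  exact Finset.coe_injective ((hf.image_eq_image_iff (fun v hv => singleton_mem_faces hA hv)
    (fun v hv => singleton_mem_faces hB hv)).1 h2)

theorem hasDim_of_map (hf : Set.InjOn f {v | {v} ∈ S.faces}) {d : ℕ} (h : (S.map f).HasDim d) :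
    S.HasDim d := by
  refine ⟨fun A hA => ?_, ?_⟩
  · rw [← card_image_of_mem_faces hf hA]
    exact h.1 _ ⟨A, hA, rfl⟩
  · obtain ⟨_, ⟨A, hA, rfl⟩, hc⟩ := h.2
    exact ⟨A, hA, by rw [← hc]; exact (card_image_of_mem_faces hf hA).symm⟩

theorem isConnected_of_map [DecidableEq V] (hf : Set.InjOn f {v | {v} ∈ S.faces})
    (h : (S.map f).IsConnected) :
    S.IsConnected := by
  have hmem : ∀ v, {v} ∈ S.faces → {f v} ∈ (S.map f).faces := fun v hv =>
    ⟨{v}, hv, Finset.image_singleton f v⟩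
  let ψ : {v : V // {v} ∈ S.faces} → {w : W // {w} ∈ (S.map f).faces} := fun v =>
    ⟨f v, hmem v v.2⟩
  have hinj : Function.Injective ψ := fun u v huv =>
    Subtype.ext (hf u.2 v.2 (congrArg Subtype.val huv))
  have hsurj : Function.Surjective ψ := by
    rintro ⟨w, A, hA, hAw⟩
    have hw : w ∈ A.image f := by
      have : w ∈ ({w} : Finset W) := Finset.mem_singleton_self w
      rwa [← hAw] at this
    obtain ⟨v, hv, rfl⟩ := Finset.mem_image.1 hw
    exact ⟨⟨v, singleton_mem_faces hA hv⟩, rfl⟩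
  let e : S.edgeGraph ≃g (S.map f).edgeGraph :=
    { Equiv.ofBijective ψ ⟨hinj, hsurj⟩ with
      map_rel_iff' := by
        intro u v
        change (ψ u ≠ ψ v ∧ {f u, f v} ∈ (S.map f).faces) ↔ (u ≠ v ∧ {(u : V), (v : V)} ∈ S.faces)
        rw [hinj.ne_iff, ← image_mem_map_faces_iff hf (A := {(u : V), (v : V)}), Finset.image_insert,
          Finset.image_singleton]
        intro x hx
        rcases Finset.mem_insert.1 hx with rfl | hx
        · exact u.2
        · rw [Finset.mem_singleton.1 hx]
          exact v.2 }
  exact e.connected_iff.2 h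

theorem faceIsomorphic_link_map [DecidableEq V] (hf : Set.InjOn f {v | {v} ∈ S.faces}) {v : V}
    (hv : {v} ∈ S.faces) : FaceIsomorphic (S.link v).faces ((S.map f).link (f v)).faces := by
  have hvert : ∀ A ∈ (S.link v).faces, ∀ u ∈ A, {u} ∈ S.faces := fun A hA u hu =>
    singleton_mem_faces hA.2.2 (Finset.mem_insert_of_mem hu)
  refine ⟨f, hf.mono ?_, fun B => ⟨?_, ?_⟩⟩
  · rintro u ⟨A, hA, hu⟩
    exact hvert A hA u hu
  · rintro ⟨hne, hvB, A, hA, hAB⟩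
    have hvA : v ∈ A := by
      have h1 : f v ∈ A.image f := by
        have := Finset.mem_insert_self (f v) B
        rwa [← hAB] at this
      obtain ⟨a, ha, hav⟩ := Finset.mem_image.1 h1
      exact hf (singleton_mem_faces hA ha) hv hav ▸ ha
    have hB : (A.erase v).image f = B := by
      ext w
      constructor
      · intro hw
        obtain ⟨a, ha, rfl⟩ := Finset.mem_image.1 hw
        rw [Finset.mem_erase] at ha
        have h1 : f a ∈ insert (f v) B := by
          rw [← hAB]
          exact Finset.mem_image_of_mem f ha.2
        exact (Finset.mem_insert.1 h1).resolve_left fun h2 =>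
          ha.1 (hf (singleton_mem_faces hA ha.2) hv h2)
      · intro hw
        have h1 : w ∈ A.image f := by
          have := Finset.mem_insert_of_mem (b := f v) hw
          rwa [← hAB] at this
        obtain ⟨a, ha, rfl⟩ := Finset.mem_image.1 h1
        exact Finset.mem_image_of_mem f (Finset.mem_erase.2 ⟨fun h => hvB (h ▸ hw), ha⟩)
    refine ⟨A.erase v, ⟨?_, Finset.notMem_erase v A, by rwa [Finset.insert_erase hvA]⟩, ?_⟩
    · rw [← hB] at hne
      exact Finset.image_nonempty.1 hne
    · rw [← hB, Finset.coe_image]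
  · rintro ⟨A, hA, hB⟩
    rw [← Finset.coe_image] at hB
    obtain rfl := Finset.coe_injective hB
    refine ⟨hA.1.image f, fun h => ?_, insert v A, hA.2.2, Finset.image_insert f v A⟩
    obtain ⟨a, ha, hav⟩ := Finset.mem_image.1 h
    exact hA.2.1 (hf (hvert A hA a ha) hv hav ▸ ha)

theorem isNeighbourly_map (hf : Set.InjOn f {v | {v} ∈ S.faces}) {l : ℕ} (h : S.IsNeighbourly l) :
    (S.map f).IsNeighbourly l := by
  intro B hne hB hc
  have hB' : ∀ w ∈ B, ∃ v, {v} ∈ S.faces ∧ f v = w := by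
    intro w hw
    obtain ⟨A, hA, hAw⟩ := hB w hw
    have hw : w ∈ A.image f := by
      have : w ∈ ({w} : Finset W) := Finset.mem_singleton_self w
      rwa [← hAw] at this
    obtain ⟨v, hv, rfl⟩ := Finset.mem_image.1 hw
    exact ⟨v, singleton_mem_faces hA hv, rfl⟩
  obtain ⟨A, hAs, rfl⟩ : ∃ A : Finset V, (A : Set V) ⊆ {v | {v} ∈ S.faces} ∧ A.image f = B := by
    have : (B : Set W) ⊆ f '' {v | {v} ∈ S.faces} := fun w hw => hB' w hw
    obtain ⟨A, hA, hAB⟩ := Finset.subset_set_image_iff.1 this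
    exact ⟨A, hA, hAB⟩
  exact ⟨A, h A (Finset.image_nonempty.1 hne) (fun v hv => hAs hv)
    (by rw [← hc, Finset.card_image_of_injOn (hf.mono hAs)]), rfl⟩

/-- A `k + 1`-neighbourly complex on a set of points, whose faces are the proper subsets exposed
by the functionals of a space of dimension `2 * k + 3`, belongs to `W_k(2 * k + 1)` up to
isomorphism. -/
theorem memW_of_map_exposed [DecidableEq V] {f : V → ℕ} {k : ℕ}
    {M : Submodule ℝ (ℕ → ℝ)} {N : Finset ℕ}
    (hf : Set.InjOn f {v | {v} ∈ S.faces}) (hM : Module.finrank ℝ M = 2 * k + 3)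
    (h1 : (1 : ℕ → ℝ) ∈ M) (hN : 2 * k + 3 ≤ N.card)
    (hK : ∀ A, A ∈ (S.map f).faces ↔ A.Nonempty ∧ A ≠ N ∧ ∃ φ, Exposes M N A φ)
    (hvert : ∀ i ∈ N, {i} ∈ (S.map f).faces) (hn : S.IsNeighbourly (k + 1)) :
    S.MemW k (2 * k + 1) := by
  have hnb : ∀ A ⊆ N, A.card ≤ k + 1 → ∃ φ, Exposes M N A φ := by
    intro A hA hc
    rcases A.eq_empty_or_nonempty with rfl | hne
    -- The constant `-1` exposes the empty set; a smaller nonempty set is a face because it extends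
    -- to one of size `k + 1`.
    · exact ⟨-1, M.neg_mem h1, hA, by simp, fun i _ _ => by simp⟩
    · obtain ⟨B, hAB, hBN, hB⟩ := Finset.exists_subsuperset_card_eq hA hc (by omega)
      have hBK := isNeighbourly_map hf hn B (hne.mono hAB) (fun i hi => hvert i (hBN hi)) hB
      exact ((hK A).1 (((S.map f).isRelLowerSet_faces hBK).2 hAB hne)).2.2
  have hgp := genPos_of_exposes hM h1 hnb
  obtain ⟨m, hm⟩ : N.Nonempty := Finset.card_pos.1 (by omega)
  refine ⟨by omega, finite_of_map hf ?_, isConnected_of_map hf ?_, hasDim_of_map hf ?_, ?_⟩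
  · refine N.powerset.finite_toSet.subset fun A hA => ?_
    obtain ⟨-, -, φ, hφ⟩ := (hK A).1 hA
    simpa using hφ.sub
  · exact GenPos.isConnected (D := 2 * k) hgp hM h1 hN hK hvert
  · exact GenPos.hasDim hgp hM hN hK ⟨_, hvert m hm⟩
  · intro v hv
    have hfv : f v ∈ N := by
      obtain ⟨-, -, φ, hφ⟩ := (hK {f v}).1 ⟨{v}, hv, Finset.image_singleton f v⟩
      simpa using hφ.sub
    obtain ⟨σ, hσ, hreach⟩ := hgp.link_reachable hM h1 hN hfv hK hnb
    exact ⟨σ, _, by omega, hreach, faceIsomorphic_link_map hf hv⟩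

end PreAbstractSimplicialComplex

/-! ### From the geometric polytope to functionals -/

theorem finrank_vectorSpan_convexHull {E : Type*} [AddCommGroup E] [Module ℝ E] (s : Set E) :
    Module.finrank ℝ (vectorSpan ℝ (convexHull ℝ s)) = Module.finrank ℝ (vectorSpan ℝ s) := by
  rw [← direction_affineSpan, affineSpan_convexHull, direction_affineSpan]

theorem proposition3p13 {V : Type*} [DecidableEq V] (k : ℕ) (S : PreAbstractSimplicialComplex V)
    (hS : S.IsPolytopalSphere (2 * k + 1)) (hn : S.IsNeighbourly (k + 1)) :
    S.MemW k (2 * k + 1) := by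
  classical
  obtain ⟨n, P, ⟨⟨s, rfl⟩, -⟩, hdim, f, hf, hfaces⟩ := hS
  obtain ⟨Q, hQ, hsQ⟩ := exists_finset_exposedPoints s
  rw [hsQ] at hQ hdim hfaces
  rw [finrank_vectorSpan_convexHull] at hdim
  have hQne : Q.Nonempty := by
    by_contra h
    rw [Finset.not_nonempty_iff_eq_empty] at h
    subst h
    rw [Finset.coe_empty, vectorSpan_empty, finrank_bot] at hdim
    omega
  obtain ⟨j, hj⟩ := Set.countable_iff_exists_injOn.1 Q.countable_toSet
  -- `p` inverts the labelling `j` and sends unused labels to a fixed vertex, so its range is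
  -- exactly `Q`.
  obtain ⟨p, hpQ, hpj⟩ : ∃ p : ℕ → EuclideanSpace ℝ (Fin n), (∀ i, p i ∈ Q) ∧
      ∀ x ∈ Q, p (j x) = x := by
    obtain ⟨q, hq⟩ := hQne
    refine ⟨fun i => if h : ∃ x ∈ Q, j x = i then h.choose else q, fun i => ?_, fun x hx => ?_⟩
    · dsimp only
      split_ifs with h
      exacts [h.choose_spec.1, hq]
    · have h : ∃ y ∈ Q, j y = j x := ⟨x, hx, rfl⟩
      simp only [dif_pos h]
      exact hj h.choose_spec.1 hx h.choose_spec.2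
  have hrange : Set.range p = (Q : Set (EuclideanSpace ℝ (Fin n))) :=
    Set.Subset.antisymm (Set.range_subset_iff.2 hpQ) fun x hx => ⟨j x, hpj x hx⟩
  have hM : Module.finrank ℝ (LinearMap.range (affineValues p)) = 2 * k + 3 := by
    rw [finrank_range_affineValues, hrange, hdim]
  have h1 : (1 : ℕ → ℝ) ∈ LinearMap.range (affineValues p) :=
    mem_range_affineValues.2 ⟨0, 1, by simp⟩
  -- A value sequence is determined by its restriction to the labels of the vertices, so `M` embeds
  -- in a space of dimension the number of vertices.
  have hN : 2 * k + 3 ≤ (Q.image j).card := by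
    have hinj : Function.Injective (restrictPoints (LinearMap.range (affineValues p))
        (Q.image j)) := by
      rw [← LinearMap.ker_eq_bot, LinearMap.ker_eq_bot']
      rintro ⟨φ, hφ⟩ h0
      refine Subtype.ext (funext fun i => ?_)
      obtain ⟨l, c, hl⟩ := mem_range_affineValues.1 hφ
      have h2 : φ (j (p i)) = 0 := congrFun h0 ⟨j (p i), Finset.mem_image_of_mem j (hpQ i)⟩
      rw [hl, hpj _ (hpQ i), ← hl] at h2
      exact h2
    have := LinearMap.finrank_le_finrank_of_injective hinj
    simpa [hM] using this
  have hexp : ∀ B ⊆ Q, B.Nonempty →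
      (B ∈ boundaryFaces (convexHull ℝ (Q : Set (EuclideanSpace ℝ (Fin n)))) ↔
        B.image j ≠ Q.image j ∧
          ∃ φ, Exposes (LinearMap.range (affineValues p)) (Q.image j) (B.image j) φ) := by
    intro B hB hne
    rw [mem_boundaryFaces_iff (hQ.trans (by rfl)) hne hB]
    have hmemB : ∀ x ∈ Q, (j x ∈ B.image j ↔ x ∈ B) := fun x hx => by
      refine ⟨fun h => ?_, Finset.mem_image_of_mem j⟩
      obtain ⟨y, hy, hyx⟩ := Finset.mem_image.1 h
      exact hj (hB hy) hx hyx ▸ hy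
    refine and_congr (not_congr ⟨fun h => by rw [h], fun h => ?_⟩) ⟨?_, ?_⟩
    · refine hB.antisymm fun x hx => (hmemB x hx).1 ?_
      rw [h]
      exact Finset.mem_image_of_mem j hx
    · rintro ⟨l, c, hzero, hneg⟩
      refine ⟨fun i => l (p i) + c, mem_range_affineValues.2 ⟨l, c, fun _ => rfl⟩,
        Finset.image_subset_image hB, fun i hi => ?_, fun i hi hiB => ?_⟩
      · obtain ⟨x, hx, rfl⟩ := Finset.mem_image.1 hi
        simpa [hpj x (hB hx)] using hzero x hx
      · obtain ⟨x, hx, rfl⟩ := Finset.mem_image.1 hi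
        simpa [hpj x hx] using hneg x hx fun h => hiB ((hmemB x hx).2 h)
    · rintro ⟨φ, hφ⟩
      obtain ⟨l, c, hl⟩ := mem_range_affineValues.1 hφ.mem
      refine ⟨l, c, fun x hx => ?_, fun x hx hxB => ?_⟩
      · have := hφ.zero (j x) (Finset.mem_image_of_mem j hx)
        rwa [hl, hpj x (hB hx)] at this
      · have := hφ.neg (j x) (Finset.mem_image_of_mem j hx) fun h => hxB ((hmemB x hx).1 h)
        rwa [hl, hpj x hx] at this
  have hfQ : ∀ A ∈ S.faces, A.image f ⊆ Q ∧
      A.image f ∈ boundaryFaces (convexHull ℝ (Q : Set (EuclideanSpace ℝ (Fin n)))) :=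
    fun A hA => by
      have h := (hfaces (A.image f)).2 ⟨A, hA, Finset.coe_image⟩
      refine ⟨Finset.coe_subset.1 ?_, h⟩
      rw [hQ]
      exact h.2.1
  have hK : ∀ A, A ∈ (S.map (j ∘ f)).faces ↔ A.Nonempty ∧ A ≠ Q.image j ∧
      ∃ φ, Exposes (LinearMap.range (affineValues p)) (Q.image j) A φ := by
    intro A
    constructor
    · rintro ⟨B, hB, rfl⟩
      obtain ⟨hBQ, hBf⟩ := hfQ B hB
      have hne := (S.isRelLowerSet_faces hB).1
      rw [hexp _ hBQ (hne.image f), Finset.image_image] at hBf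
      exact ⟨hne.image _, hBf⟩
    · rintro ⟨hne, hAQ, φ, hφ⟩
      obtain ⟨B, hBQ, rfl⟩ := Finset.subset_image_iff.1 hφ.sub
      obtain ⟨A, hA, hAB⟩ := (hfaces B).1
        ((hexp B hBQ (Finset.image_nonempty.1 hne)).2 ⟨hAQ, φ, hφ⟩)
      rw [← Finset.coe_image] at hAB
      obtain rfl := Finset.coe_injective hAB
      exact ⟨A, hA, Finset.image_image.symm⟩
  refine PreAbstractSimplicialComplex.memW_of_map_exposed (f := j ∘ f) ?_ hM h1 hN hK ?_ hn
  · intro u hu v hv huv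
    have hmem : ∀ {u}, {u} ∈ S.faces → f u ∈ Q := fun {u} hu =>
      (hfQ _ hu).1 (Finset.mem_image_of_mem f (Finset.mem_singleton_self u))
    exact hf ⟨_, hu, Finset.mem_singleton_self u⟩ ⟨_, hv, Finset.mem_singleton_self v⟩
      (hj (hmem hu) (hmem hv) huv)
  · intro i hi
    obtain ⟨x, hx, rfl⟩ := Finset.mem_image.1 hi
    rw [hK]
    have hxs : ({x} : Finset (EuclideanSpace ℝ (Fin n))) ⊆ Q := Finset.singleton_subset_iff.2 hx
    refine ⟨Finset.singleton_nonempty _, fun h => ?_, ?_⟩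
    · rw [← h] at hN
      simp at hN
    · have hx' := hx
      rw [← Finset.mem_coe, hQ] at hx'
      obtain ⟨-, l, hl⟩ := hx'
      refine ⟨fun i => l (p i) - l x, mem_range_affineValues.2
        ⟨l.toLinearMap, -l x, fun i => sub_eq_add_neg _ _⟩,
        Finset.singleton_subset_iff.2 (Finset.mem_image_of_mem j hx), fun i hi => ?_,
        fun i hi hix => ?_⟩
      · rw [Finset.mem_singleton.1 hi, hpj x hx, sub_self]
      · obtain ⟨y, hy, rfl⟩ := Finset.mem_image.1 hi
        have hly := hl y (subset_convexHull _ _ hy)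
        rw [hpj y hy, sub_neg]
        refine lt_of_le_of_ne hly.1 fun h => hix ?_
        rw [hly.2 h.ge]
        exact Finset.mem_singleton_self _
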